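/- All graphs are simple, undirected, finite and connected. Let $X=(X_n)_{n\in\mathbb N}$ be a sequence of such graphs. A sequence $Y=(Y_n)$ of connected graphs with $V(Y_n)=V(X_n)$ *induces the same coarse structure* as $X$ if there is a constant $L$ with $d_{X_n}(x,y)\le L\,d_{Y_n}(x,y)$ and $d_{Y_n}(x,y)\le L\,d_{X_n}(x,y)$ for all $n$ and all $x,y\in V(X_n)$ (path distances). The *combinatorial cost* of $X$ is $$c(X)=\inf_Y\ \liminf_{n\to\infty}\frac{|E(Y_n)|}{|V(X_n)|},$$ the infimum being over all sequences $Y$ inducing the same coarse structure as $X$. For a graph $G$ and an integer $R$, let $Z_R(G)$ be the subspace of the real vector space generated by the oriented edges of $G$, subject to $(x,y)=-(y,x)$, spanned by the elements $(x_1,x_2)+\dots+(x_{q-1},x_q)+(x_q,x_1)$ for all cycles $(x_1,\dots,x_q)$ of $G$ of length $q\le R$. Assume now that $X$ has uniformly bounded degree. The algebraic uniform Roe algebra $\mathbb C_{cs}[X]$ is the $*$-algebra of all $T=(T_n)\in\prod_n B(\ell^2V(X_n))$ (uniformly bounded operator norms) of finite propagation, i.e. such that for some $r$ the matrix entry $(T_n)_{xy}$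 vanishes for all $n$ and all $x,y$ with $d_{X_n}(x,y)>r$. The maximal uniform Roe algebra $C^*_{\max}(X)$ is its completion in the norm $\|T\|_{\max}=\sup_\pi\|\pi(T)\|$, over all unital $*$-homomorphisms $\pi$ from $\mathbb C_{cs}[X]$ to the bounded operators on a complex Hilbert space. The Laplacian $\Delta_X=(\Delta_{X_n})_n$, with $\Delta_{X_n}$ the degree matrix minus the adjacency matrix, is an element of $\mathbb C_{cs}[X]$. The sequence $X$ has *geometric property (T)* if its graphs are connected of uniformly bounded degree, $|V(X_n)|\to\infty$, and there is $\gamma>0$ such that the spectrum of $\Delta_X$ in $C^*_{\max}(X)$ is contained in $\{0\}\cup[\gamma,\infty)$. **Proposition.** (i) Suppose that all vertices of all $X_n$ have degree at most $d$ and that there are an integer $R>0$ and a real $\epsilon>0$ such that $\dim Z_R(X_n)\ge\epsilon|V(X_n)|$ for all $n$. Then $$c(X)\le\liminf_{n\to\infty}\frac{|E(X_n)|}{|V(X_n)|}-\frac{\epsilon}{d^{R-1}}.$$ (ii) If $X$ has geometric property (T), then the infimum defining $c(X)$ is not attained: there is no sequence $Y$ inducing the same coarse structure as $X$ with $\liminf_n\frac{|E(Y_n)|}{|V(X_n)|}=c(X)$.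 -/

import Mathlib

open Filter Topology

universe u

/-! ### Cycle spaces -/

section CycleSpaces

variable {W : Type u}

/-- The oriented edge `(x, y)` as an element of the real edge space: the space of oriented edges
with `(x, y) = -(y, x)` is realised as antisymmetric functions on ordered pairs of vertices. -/
noncomputable def orientedEdge (x y : W) : (W × W) →₀ ℝ :=
  Finsupp.single (x, y) 1 - Finsupp.single (y, x) 1

/-- The element `(x₁, x₂) + (x₂, x₃) + ⋯` of the edge space given by a walk `x₁, x₂, x₃, …`. -/
noncomputable def walkChain {G : SimpleGraph W} {x y : W} (p : G.Walk x y) : (W × W) →₀ ℝ :=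
  (p.darts.map fun e => orientedEdge e.fst e.snd).sum

/-- `Z_R(G)`: the span of the cycles of length at most `R`. -/
noncomputable def shortCycleSpace (G : SimpleGraph W) (R : ℕ) : Submodule ℝ ((W × W) →₀ ℝ) :=
  Submodule.span ℝ {z | ∃ (x : W) (p : G.Walk x x), p.IsCycle ∧ p.length ≤ R ∧ z = walkChain p}

end CycleSpaces

/-! ### Combinatorial cost -/

section Cost

variable {V : ℕ → Type u}

/-- Two sequences of connected graphs on the same vertex sets induce the same coarse structure:
their path metrics are bi-Lipschitz equivalent with one constant for all `n`. -/
def SameCoarseStructure (X Y : ∀ n, SimpleGraph (V n)) : Prop :=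
  (∀ n, (X n).Connected) ∧ (∀ n, (Y n).Connected) ∧
    ∃ L : ℝ, ∀ n (x y : V n),
      ((X n).dist x y : ℝ) ≤ L * (Y n).dist x y ∧ ((Y n).dist x y : ℝ) ≤ L * (X n).dist x y

/-- `liminf_n |E(Y_n)| / |V(Y_n)|`. -/
noncomputable def liminfEdgeDensity [∀ n, Fintype (V n)] (Y : ∀ n, SimpleGraph (V n)) : ℝ :=
  liminf (fun n => ((Y n).edgeSet.ncard : ℝ) / (Fintype.card (V n) : ℝ)) atTop

/-- The combinatorial cost `c(X)`: the infimum of `liminf_n |E(Y_n)| / |V(X_n)|` over all sequences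
`Y` that induce the same coarse structure as `X`. -/
noncomputable def combinatorialCost [∀ n, Fintype (V n)] (X : ∀ n, SimpleGraph (V n)) : ℝ :=
  sInf {c : ℝ | ∃ Y : ∀ n, SimpleGraph (V n), SameCoarseStructure X Y ∧ c = liminfEdgeDensity Y}

end Cost

/-! ### Uniform Roe algebras and geometric property (T) -/

section Roe

variable {V : ℕ → Type u}

/-- All vertices of all graphs of the sequence have degree at most `d`. -/
def DegreeAtMost (X : ∀ n, SimpleGraph (V n)) (d : ℕ) : Prop :=
  ∀ n (x : V n), ((X n).neighborSet x).ncard ≤ d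

/-- The sequence has uniformly bounded degree. -/
class UniformlyBoundedDegree (X : ∀ n, SimpleGraph (V n)) : Prop where
  exists_bound : ∃ d : ℕ, DegreeAtMost X d

/-- `T` has finite propagation: its entries vanish outside a uniform neighbourhood of the diagonal. -/
def FinitePropagation (X : ∀ n, SimpleGraph (V n)) (T : ∀ n, Matrix (V n) (V n) ℂ) : Prop :=
  ∃ R : ℕ, ∀ n (x y : V n), T n x y ≠ 0 → (X n).edist x y ≤ R

variable [∀ n, Fintype (V n)] [∀ n, DecidableEq (V n)]

/-- The operator norms of the matrices `T n`, acting on the Hilbert spaces `L²(X_n)`, are bounded,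
i.e. `T` lies in the product `∏ B(L²(X_n))`. -/
def IsBoundedSeq (T : ∀ n, Matrix (V n) (V n) ℂ) : Prop :=
  ∃ C : ℝ, ∀ n, ‖Matrix.toEuclideanCLM (𝕜 := ℂ) (T n)‖ ≤ C

/-- The algebraic uniform Roe algebra, inside the product of all matrix algebras. -/
def roeSubalgebra (X : ∀ n, SimpleGraph (V n)) :
    StarSubalgebra ℂ (∀ n, Matrix (V n) (V n) ℂ) where
  carrier := {T | IsBoundedSeq T ∧ FinitePropagation X T}
  mul_mem' := by
    rintro S T ⟨⟨C, hC⟩, R, hR⟩ ⟨⟨D, hD⟩, Q, hQ⟩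
    refine ⟨⟨C * D, fun n => ?_⟩, R + Q, fun n x y h => ?_⟩
    · rw [Pi.mul_apply, map_mul]
      exact (norm_mul_le _ _).trans
        (mul_le_mul (hC n) (hD n) (norm_nonneg _) ((norm_nonneg _).trans (hC n)))
    · rw [Pi.mul_apply, Matrix.mul_apply] at h
      obtain ⟨z, -, hz⟩ := Finset.exists_ne_zero_of_sum_ne_zero h
      have h1 := hR n x z (left_ne_zero_of_mul hz)
      have h2 := hQ n z y (right_ne_zero_of_mul hz)
      push_cast
      exact (X n).edist_triangle.trans (add_le_add h1 h2)
  add_mem' := by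
    rintro S T ⟨⟨C, hC⟩, R, hR⟩ ⟨⟨D, hD⟩, Q, hQ⟩
    refine ⟨⟨C + D, fun n => ?_⟩, max R Q, fun n x y h => ?_⟩
    · rw [Pi.add_apply, map_add]
      exact (norm_add_le _ _).trans (add_le_add (hC n) (hD n))
    · by_cases hS : S n x y = 0
      · have hT : T n x y ≠ 0 := by
          intro hT
          exact h (by simp [hS, hT])
        exact (hQ n x y hT).trans (by exact_mod_cast le_max_right R Q)
      · exact (hR n x y hS).trans (by exact_mod_cast le_max_left R Q)
  algebraMap_mem' := by
    intro c
    refine ⟨⟨‖c‖, fun n => ?_⟩, 0, fun n x y h => ?_⟩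
    · rw [Pi.algebraMap_apply, AlgHomClass.commutes, Algebra.algebraMap_eq_smul_one]
      refine (norm_smul_le _ _).trans ?_
      exact mul_le_of_le_one_right (norm_nonneg c) ContinuousLinearMap.norm_id_le
    · have hxy : x = y := by
        by_contra hxy
        exact h (by simp [Pi.algebraMap_apply, Matrix.algebraMap_matrix_apply, hxy])
      simp [hxy]
  star_mem' := by
    rintro T ⟨⟨C, hC⟩, R, hR⟩
    refine ⟨⟨C, fun n => ?_⟩, R, fun n x y h => ?_⟩
    · rw [Pi.star_apply, map_star, ContinuousLinearMap.star_eq_adjoint,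
        LinearIsometryEquiv.norm_map]
      exact hC n
    · rw [SimpleGraph.edist_comm]
      refine hR n y x fun h0 => h ?_
      simp [Matrix.star_apply, h0]

/-- The algebraic uniform Roe algebra `ℂ_cs[X]`. It is a type of its own, so that it can be given
the maximal norm. -/
def AlgebraicRoe (X : ∀ n, SimpleGraph (V n)) : Type u := roeSubalgebra X

noncomputable instance (X : ∀ n, SimpleGraph (V n)) : Ring (AlgebraicRoe X) :=
  inferInstanceAs (Ring (roeSubalgebra X))

noncomputable instance (X : ∀ n, SimpleGraph (V n)) : StarRing (AlgebraicRoe X) :=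
  inferInstanceAs (StarRing (roeSubalgebra X))

noncomputable instance (X : ∀ n, SimpleGraph (V n)) : Algebra ℂ (AlgebraicRoe X) :=
  inferInstanceAs (Algebra ℂ (roeSubalgebra X))

/-- A representation of `ℂ_cs[X]`: a complex Hilbert space `H` and a unital `*`-homomorphism from
`ℂ_cs[X]` to the bounded operators on `H`. -/
structure RoeRepresentation (X : ∀ n, SimpleGraph (V n)) where
  H : Type u
  [normedAddCommGroup : NormedAddCommGroup H]
  [innerProductSpace : InnerProductSpace ℂ H]
  [completeSpace : CompleteSpace H]
  hom : AlgebraicRoe X →⋆ₐ[ℂ] (H →L[ℂ] H)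

attribute [instance] RoeRepresentation.normedAddCommGroup RoeRepresentation.innerProductSpace
  RoeRepresentation.completeSpace

/-- The maximal norm `‖T‖_max = sup ‖π(T)‖`, over all representations `π`. -/
noncomputable def maxNorm (X : ∀ n, SimpleGraph (V n)) (T : AlgebraicRoe X) : ℝ :=
  ⨆ π : RoeRepresentation X, ‖π.hom T‖

end Roe

/-! ### Finiteness of the maximal norm in uniformly bounded degree -/

section Finiteness

variable {V : ℕ → Type u}

theorem exists_ball_bound (X : ∀ n, SimpleGraph (V n)) [∀ n, Fintype (V n)]
    [hX : UniformlyBoundedDegree X] (R : ℕ) :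
    ∃ N : ℕ, ∀ n (x : V n), {y | (X n).edist x y ≤ R}.ncard ≤ N := by
  classical
  obtain ⟨d, hd⟩ := hX.exists_bound
  induction R with
  | zero =>
    refine ⟨1, fun n x => ?_⟩
    have : {y | (X n).edist x y ≤ (0 : ℕ)} = {x} := by
      ext y
      simp only [Nat.cast_zero, nonpos_iff_eq_zero, SimpleGraph.edist_eq_zero_iff,
        Set.mem_ofPred_eq, Set.mem_singleton_iff]
      exact eq_comm
    rw [this, Set.ncard_singleton]
  | succ R ih =>
    obtain ⟨N, hN⟩ := ih
    refine ⟨1 + d * N, fun n x => ?_⟩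
    have hsub : {y | (X n).edist x y ≤ (R + 1 : ℕ)} ⊆
        {x} ∪ ⋃ z ∈ ((X n).neighborSet x).toFinset, {y | (X n).edist z y ≤ R} := by
      intro y hy
      have hy' : (X n).edist x y ≤ (R + 1 : ℕ) := hy
      have htop : (X n).edist x y ≠ ⊤ := ne_top_of_le_ne_top (ENat.natCast_ne_top _) hy'
      obtain ⟨p, hp⟩ := SimpleGraph.exists_walk_of_edist_ne_top htop
      rw [← hp] at hy'
      have hlen : p.length ≤ R + 1 := by exact_mod_cast hy'
      cases p with
      | nil => simp
      | cons h q =>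
        right
        rw [SimpleGraph.Walk.length_cons] at hlen
        simp only [Set.mem_iUnion]
        refine ⟨_, by simpa using h, ?_⟩
        refine (SimpleGraph.edist_le q).trans ?_
        exact_mod_cast Nat.le_of_succ_le_succ hlen
    refine (Set.ncard_le_ncard hsub (Set.toFinite _)).trans ?_
    refine (Set.ncard_union_le _ _).trans ?_
    rw [Set.ncard_singleton]
    refine Nat.add_le_add_left ((Finset.set_ncard_biUnion_le _ _).trans ?_) 1
    refine (Finset.sum_le_card_nsmul _ _ N fun z _ => hN n z).trans ?_
    rw [smul_eq_mul, ← Set.ncard_eq_toFinset_card']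
    exact Nat.mul_le_mul_right N (hd n x)

theorem norm_le_sqrt_of_star_mul_add {H : Type*} [NormedAddCommGroup H] [InnerProductSpace ℂ H]
    [CompleteSpace H] (A B : H →L[ℂ] H) (c : ℝ)
    (h : star A * A + star B * B = algebraMap ℂ (H →L[ℂ] H) (c : ℂ)) : ‖A‖ ≤ √c := by
  refine A.opNorm_le_bound (Real.sqrt_nonneg c) fun x => ?_
  have key : ∀ D : H →L[ℂ] H, inner ℂ x ((star D * D) x) = ((‖D x‖ ^ 2 : ℝ) : ℂ) := by
    intro D
    rw [mul_apply_eq_comp, ContinuousLinearMap.star_eq_adjoint,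
      ContinuousLinearMap.adjoint_inner_right, inner_self_eq_norm_sq_to_K]
    simp
  have hx := congrArg (fun D : H →L[ℂ] H => inner ℂ x (D x)) h
  simp only [add_apply, inner_add_right, key,
    Algebra.algebraMap_eq_smul_one, smul_apply,
    one_apply_eq_self, inner_smul_right, inner_self_eq_norm_sq_to_K] at hx
  have hx' : ‖A x‖ ^ 2 + ‖B x‖ ^ 2 = c * ‖x‖ ^ 2 := by
    have hx2 := congrArg Complex.re hx
    simpa [← Complex.ofReal_pow] using hx2
  have h1 : ‖A x‖ ^ 2 ≤ c * ‖x‖ ^ 2 := by nlinarith [sq_nonneg ‖B x‖]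
  rw [← Real.sqrt_sq (norm_nonneg x), ← Real.sqrt_mul' c (sq_nonneg ‖x‖)]
  exact Real.le_sqrt_of_sq_le h1

theorem exists_diagonal_complement {W : Type*} [Fintype W] [DecidableEq W] (A : Matrix W W ℂ)
    (hrow : ∀ x y z, A x y ≠ 0 → A x z ≠ 0 → y = z) (c : ℝ)
    (hcol : ∀ y, ∑ x, ‖A x y‖ ^ 2 ≤ c) :
    ∃ s : W → ℂ, star A * A + star (Matrix.diagonal s) * Matrix.diagonal s =
      algebraMap ℂ (Matrix W W ℂ) (c : ℂ) := by
  refine ⟨fun y => ((√(c - ∑ x, ‖A x y‖ ^ 2) : ℝ) : ℂ), ?_⟩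
  ext y z
  rw [Matrix.star_eq_conjTranspose, Matrix.star_eq_conjTranspose, Matrix.diagonal_conjTranspose,
    Matrix.diagonal_mul_diagonal, Matrix.add_apply, Matrix.mul_apply,
    Matrix.algebraMap_matrix_apply]
  by_cases hyz : y = z
  · subst hyz
    simp only [Matrix.diagonal_apply_eq, Matrix.conjTranspose_apply, if_true, Pi.star_apply]
    have h1 : ∀ x, star (A x y) * A x y = ((‖A x y‖ ^ 2 : ℝ) : ℂ) := by
      intro x
      rw [Complex.star_def, Complex.conj_mul']
      simp
    rw [Finset.sum_congr rfl fun x _ => h1 x, Complex.star_def, Complex.conj_ofReal,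
      ← Complex.ofReal_mul, Real.mul_self_sqrt (sub_nonneg.2 (hcol y)), ← Complex.ofReal_sum,
      ← Complex.ofReal_add]
    simp
  · rw [Matrix.diagonal_apply_ne _ hyz, if_neg hyz, add_zero]
    refine Finset.sum_eq_zero fun x _ => ?_
    rw [Matrix.conjTranspose_apply]
    by_contra h
    have h1 : A x y ≠ 0 := fun h0 => h (by simp [h0])
    exact hyz (hrow x y z h1 (right_ne_zero_of_mul h))

variable [∀ n, Fintype (V n)] [∀ n, DecidableEq (V n)]

/-- Entries of finite-propagation matrices in a bounded degree sequence can be sorted into finitely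
many matrices with at most one entry in each row. -/
theorem exists_row_decomposition (X : ∀ n, SimpleGraph (V n)) [UniformlyBoundedDegree X]
    (T : ∀ n, Matrix (V n) (V n) ℂ) (hT : FinitePropagation X T) (M : ℝ)
    (hM : ∀ n x y, ‖T n x y‖ ≤ M) :
    ∃ (N : ℕ) (c : ℝ) (A B : ℕ → ∀ n, Matrix (V n) (V n) ℂ),
      T = ∑ k ∈ Finset.range N, A k ∧
      ∀ k, FinitePropagation X (A k) ∧ FinitePropagation X (B k) ∧
        star (A k) * A k + star (B k) * B k =
          algebraMap ℂ (∀ n, Matrix (V n) (V n) ℂ) (c : ℂ) := by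
  classical
  obtain ⟨R, hR⟩ := hT
  obtain ⟨N, hN⟩ := exists_ball_bound X R
  let b : ∀ n, V n → Finset (V n) := fun n x => {y | (X n).edist x y ≤ R}.toFinset
  have hb : ∀ n x, (b n x).card ≤ N := fun n x => by
    rw [← Set.ncard_eq_toFinset_card']
    exact hN n x
  have hmem : ∀ n x y, T n x y ≠ 0 → y ∈ b n x := fun n x y h => by
    simpa [b] using hR n x y h
  let idx : ∀ n, V n → V n → ℕ := fun n x y =>
    if h : y ∈ b n x then ((b n x).equivFin ⟨y, h⟩ : ℕ) else 0
  have hidx : ∀ n x y, y ∈ b n x → idx n x y < N := fun n x y h => by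
    simp only [idx, dif_pos h]
    exact (Fin.is_lt _).trans_le (hb n x)
  have hinj : ∀ n x y z, y ∈ b n x → z ∈ b n x → idx n x y = idx n x z → y = z := by
    intro n x y z hy hz h
    simp only [idx, dif_pos hy, dif_pos hz] at h
    simpa using (b n x).equivFin.injective (Fin.ext h)
  let A : ℕ → ∀ n, Matrix (V n) (V n) ℂ := fun k n =>
    Matrix.of fun x y => if idx n x y = k then T n x y else 0
  have hA : ∀ k n x y, A k n x y = if idx n x y = k then T n x y else 0 := fun _ _ _ _ => rfl
  have hAT : ∀ k n x y, A k n x y ≠ 0 → idx n x y = k ∧ T n x y ≠ 0 := by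
    intro k n x y h
    rw [hA] at h
    by_cases hk : idx n x y = k
    · rw [if_pos hk] at h
      exact ⟨hk, h⟩
    · rw [if_neg hk] at h
      exact absurd rfl h
  have hAM : ∀ k n x y, ‖A k n x y‖ ≤ ‖T n x y‖ := by
    intro k n x y
    rw [hA]
    split_ifs <;> simp
  have hcol : ∀ k n y, ∑ x, ‖A k n x y‖ ^ 2 ≤ N * M ^ 2 := by
    intro k n y
    have h1 : ∑ x, ‖A k n x y‖ ^ 2 = ∑ x ∈ b n y, ‖A k n x y‖ ^ 2 := by
      refine (Finset.sum_subset (Finset.subset_univ _) fun x _ hx => ?_).symm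
      by_contra h
      have h0 : A k n x y ≠ 0 := fun h0 => h (by simp [h0])
      have h2 := hR n x y (hAT k n x y h0).2
      rw [SimpleGraph.edist_comm] at h2
      exact hx (by simpa [b] using h2)
    rw [h1]
    refine (Finset.sum_le_card_nsmul _ _ (M ^ 2) fun x _ => ?_).trans ?_
    · exact pow_le_pow_left₀ (norm_nonneg _) ((hAM k n x y).trans (hM n x y)) 2
    · rw [nsmul_eq_mul]
      exact mul_le_mul_of_nonneg_right (by exact_mod_cast hb n y) (sq_nonneg M)
  have hrow : ∀ k n x y z, A k n x y ≠ 0 → A k n x z ≠ 0 → y = z := by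
    intro k n x y z hy hz
    obtain ⟨hy1, hy2⟩ := hAT k n x y hy
    obtain ⟨hz1, hz2⟩ := hAT k n x z hz
    exact hinj n x y z (hmem n x y hy2) (hmem n x z hz2) (hy1.trans hz1.symm)
  choose s hs using fun k n => exists_diagonal_complement (A k n) (hrow k n) _ (hcol k n)
  refine ⟨N, N * M ^ 2, A, fun k n => Matrix.diagonal (s k n), ?_, fun k => ⟨?_, ?_, ?_⟩⟩
  · funext n
    ext x y
    rw [Finset.sum_apply, Matrix.sum_apply]
    by_cases h : T n x y = 0
    · simp [hA, h]
    · simp only [hA]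
      rw [Finset.sum_ite_eq, if_pos (Finset.mem_range.2 (hidx n x y (hmem n x y h)))]
  · exact ⟨R, fun n x y h => hR n x y (hAT k n x y h).2⟩
  · refine ⟨0, fun n x y h => ?_⟩
    have hxy : x = y := by
      by_contra hxy
      exact h (Matrix.diagonal_apply_ne _ hxy)
    simp [hxy]
  · funext n
    exact hs k n

theorem isBoundedSeq_of_star_mul_add (A B : ∀ n, Matrix (V n) (V n) ℂ) (c : ℝ)
    (h : star A * A + star B * B = algebraMap ℂ (∀ n, Matrix (V n) (V n) ℂ) (c : ℂ)) :
    IsBoundedSeq A := by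
  refine ⟨√c, fun n => norm_le_sqrt_of_star_mul_add _
    (Matrix.toEuclideanCLM (𝕜 := ℂ) (B n)) c ?_⟩
  have hn := congrArg (Matrix.toEuclideanCLM (𝕜 := ℂ)) (congrFun h n)
  simpa only [Pi.add_apply, Pi.mul_apply, Pi.star_apply, map_add, map_mul, map_star,
    Pi.algebraMap_apply, AlgHomClass.commutes] using hn

/-- In a bounded degree sequence, matrices of finite propagation with bounded entries belong to the
algebraic uniform Roe algebra. -/
theorem mem_roeSubalgebra_of_entries (X : ∀ n, SimpleGraph (V n)) [UniformlyBoundedDegree X]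
    (T : ∀ n, Matrix (V n) (V n) ℂ) (hT : FinitePropagation X T) (M : ℝ)
    (hM : ∀ n x y, ‖T n x y‖ ≤ M) : T ∈ roeSubalgebra X := by
  obtain ⟨N, c, A, B, hsum, hAB⟩ := exists_row_decomposition X T hT M hM
  rw [hsum]
  exact sum_mem fun k _ => ⟨isBoundedSeq_of_star_mul_add _ _ c (hAB k).2.2, (hAB k).1⟩

theorem bddAbove_representation_norms (X : ∀ n, SimpleGraph (V n)) [UniformlyBoundedDegree X]
    (T : AlgebraicRoe X) :
    BddAbove (Set.range fun π : RoeRepresentation X => ‖π.hom T‖) := by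
  obtain ⟨T, ⟨C, hC⟩, hT⟩ := T
  have hM : ∀ n x y, ‖T n x y‖ ≤ C := by
    intro n x y
    have h1 := (Matrix.toEuclideanCLM (𝕜 := ℂ) (T n)).le_opNorm (EuclideanSpace.single y 1)
    rw [PiLp.norm_single, norm_one, mul_one] at h1
    have h2 := PiLp.norm_apply_le
      (Matrix.toEuclideanCLM (𝕜 := ℂ) (T n) (EuclideanSpace.single y 1)) x
    have h3 : Matrix.toEuclideanCLM (𝕜 := ℂ) (T n) (EuclideanSpace.single y 1) x = T n x y := by
      rw [Matrix.ofLp_toEuclideanCLM]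
      simp
    rw [h3] at h2
    exact h2.trans (h1.trans (hC n))
  obtain ⟨N, c, A, B, hsum, hAB⟩ := exists_row_decomposition X T hT C hM
  let a : ℕ → AlgebraicRoe X := fun k =>
    ⟨A k, isBoundedSeq_of_star_mul_add _ _ c (hAB k).2.2, (hAB k).1⟩
  let b : ℕ → AlgebraicRoe X := fun k =>
    ⟨B k, isBoundedSeq_of_star_mul_add _ _ c ((add_comm _ _).trans (hAB k).2.2), (hAB k).2.1⟩
  have hab : ∀ k, star (a k) * a k + star (b k) * b k = algebraMap ℂ (AlgebraicRoe X) (c : ℂ) :=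
    fun k => Subtype.ext (hAB k).2.2
  have hTa : (⟨T, ⟨C, hC⟩, hT⟩ : AlgebraicRoe X) = ∑ k ∈ Finset.range N, a k := by
    refine Subtype.ext (hsum.trans ?_)
    exact (map_sum (roeSubalgebra X).subtype (fun k => (a k : roeSubalgebra X)) _).symm
  refine ⟨∑ k ∈ Finset.range N, √c, ?_⟩
  rintro _ ⟨π, rfl⟩
  simp only
  rw [hTa, map_sum]
  refine norm_sum_le_of_le _ fun k _ => norm_le_sqrt_of_star_mul_add _ (π.hom (b k)) c ?_
  rw [← map_star, ← map_star, ← map_mul, ← map_mul, ← map_add, hab k, AlgHomClass.commutes]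

end Finiteness

/-! ### The maximal uniform Roe algebra and geometric property (T) -/

section GeometricT

variable {V : ℕ → Type u} [∀ n, Fintype (V n)] [∀ n, DecidableEq (V n)]

theorem representation_norm_le_maxNorm (X : ∀ n, SimpleGraph (V n)) [UniformlyBoundedDegree X]
    (π : RoeRepresentation X) (T : AlgebraicRoe X) : ‖π.hom T‖ ≤ maxNorm X T :=
  le_ciSup (bddAbove_representation_norms X T) π

theorem maxNorm_nonneg (X : ∀ n, SimpleGraph (V n)) (T : AlgebraicRoe X) : 0 ≤ maxNorm X T :=
  Real.iSup_nonneg fun _ => norm_nonneg _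

/-- The maximal norm as a seminorm on the additive group of `ℂ_cs[X]`. -/
noncomputable def maxAddGroupSeminorm (X : ∀ n, SimpleGraph (V n)) [UniformlyBoundedDegree X] :
    AddGroupSeminorm (AlgebraicRoe X) where
  toFun := maxNorm X
  map_zero' := by simp [maxNorm]
  add_le' S T := by
    refine Real.iSup_le (fun π => ?_) (add_nonneg (maxNorm_nonneg X S) (maxNorm_nonneg X T))
    rw [map_add]
    exact (norm_add_le _ _).trans (add_le_add (representation_norm_le_maxNorm X π S)
      (representation_norm_le_maxNorm X π T))
  neg' T := by simp [maxNorm]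

/-- `ℂ_cs[X]` with the maximal norm, for a sequence of uniformly bounded degree. -/
noncomputable instance (X : ∀ n, SimpleGraph (V n)) [UniformlyBoundedDegree X] :
    SeminormedRing (AlgebraicRoe X) where
  toRing := inferInstance
  toNorm := (maxAddGroupSeminorm X).toSeminormedAddCommGroup.toNorm
  toPseudoMetricSpace := (maxAddGroupSeminorm X).toSeminormedAddCommGroup.toPseudoMetricSpace
  dist_eq := (maxAddGroupSeminorm X).toSeminormedAddCommGroup.dist_eq
  norm_mul_le S T := by
    change maxNorm X (S * T) ≤ maxNorm X S * maxNorm X T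
    refine Real.iSup_le (fun π => ?_) (mul_nonneg (maxNorm_nonneg X S) (maxNorm_nonneg X T))
    rw [map_mul]
    exact (norm_mul_le _ _).trans (mul_le_mul (representation_norm_le_maxNorm X π S)
      (representation_norm_le_maxNorm X π T) (norm_nonneg _) (maxNorm_nonneg X S))

noncomputable instance (X : ∀ n, SimpleGraph (V n)) [UniformlyBoundedDegree X] :
    NormedAlgebra ℂ (AlgebraicRoe X) where
  norm_smul_le c T := by
    change maxNorm X (c • T) ≤ ‖c‖ * maxNorm X T
    refine Real.iSup_le (fun π => ?_) (mul_nonneg (norm_nonneg c) (maxNorm_nonneg X T))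
    rw [map_smul, norm_smul]
    exact mul_le_mul_of_nonneg_left (representation_norm_le_maxNorm X π T) (norm_nonneg c)

/-- The maximal uniform Roe algebra `C*_max(X)`: the completion of `ℂ_cs[X]` in the maximal norm. -/
abbrev MaxRoe (X : ∀ n, SimpleGraph (V n)) [UniformlyBoundedDegree X] : Type u :=
  UniformSpace.Completion (AlgebraicRoe X)

open Classical in
/-- The Laplacian `Δ_X = ⨁ Δ_{X_n}` as an element of `ℂ_cs[X]`. -/
noncomputable def roeLaplacian (X : ∀ n, SimpleGraph (V n)) [hX : UniformlyBoundedDegree X] :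
    AlgebraicRoe X :=
  ⟨fun n => (X n).lapMatrix ℂ, by
    obtain ⟨d, hd⟩ := hX.exists_bound
    refine mem_roeSubalgebra_of_entries X _ ⟨1, fun n x y h => ?_⟩ (d + 1) fun n x y => ?_
    · rw [Nat.cast_one, SimpleGraph.edist_le_one_iff_adj_or_eq]
      by_contra! hxy
      exact h (by simp [SimpleGraph.lapMatrix, SimpleGraph.degMatrix, hxy.1, hxy.2])
    · have hdeg : ((X n).degree x : ℝ) ≤ d := by
        have := hd n x
        rw [Set.ncard_eq_toFinset_card'] at this
        exact_mod_cast this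
      have hd0 : (0 : ℝ) ≤ d := Nat.cast_nonneg d
      by_cases hxy : x = y
      · subst hxy
        simp only [SimpleGraph.lapMatrix, SimpleGraph.degMatrix, Matrix.sub_apply,
          Matrix.diagonal_apply_eq, SimpleGraph.adjMatrix_apply, SimpleGraph.irrefl, if_false,
          sub_zero, Complex.norm_natCast]
        linarith
      · simp only [SimpleGraph.lapMatrix, SimpleGraph.degMatrix, Matrix.sub_apply,
          Matrix.diagonal_apply_ne _ hxy, SimpleGraph.adjMatrix_apply, zero_sub, norm_neg]
        split_ifs
        · rw [norm_one]
          linarith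
        · rw [norm_zero]
          linarith⟩

/-- Geometric property (T) for a sequence of finite graphs: the graphs are connected, the number of
vertices goes to infinity, the degrees are uniformly bounded, and the spectrum of the Laplacian in
the maximal uniform Roe algebra is contained in `{0} ∪ [γ, ∞)` for some `γ > 0`. -/
def GeometricPropertyT (X : ∀ n, SimpleGraph (V n)) : Prop :=
  (∀ n, (X n).Connected) ∧ Tendsto (fun n => Fintype.card (V n)) atTop atTop ∧
    ∃ _ : UniformlyBoundedDegree X, ∃ γ : ℝ, 0 < γ ∧
      spectrum ℂ ((roeLaplacian X : AlgebraicRoe X) : MaxRoe X) ⊆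
        {0} ∪ Complex.ofReal '' Set.Ici γ

end GeometricT

/-! Both parts rest on edges with short detours: edges whose end points are joined by a walk of
length at most `k` avoiding the edge. Fix one detour for each such edge. "f lies on the detour of e"
is a digraph of out-degree at most `k`, so an independent set of these edges has proportion at least
`1/(2k+1)`. Deleting it leaves the detours of the deleted edges intact, so distances grow by a
factor at most `k` while a positive proportion of the detour edges disappears
(`exists_sparser_of_degree_le`). Many detour edges in `Y` therefore make the cost drop strictly
below the edge density of `Y` (`combinatorialCost_le_sub`).

For (i), removing one edge from a cycle of length at most `R` leaves a detour of length at most `R -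
1`. So `Z_R` is spanned by edges of this kind, and its dimension bounds their number from below.

For (ii), it suffices that property (T) forces a positive density of detour edges, for some `k`, in
every `Y` inducing the same coarse structure. Otherwise, along an ultrafilter, most balls of `Y` are
trees. On a tree the kernel `t ^ d(x, y)` is positive definite, so averaging the entries of `T`
against `t ^ d_Y(x, y)` gives in the limit a positive functional on `ℂ_cs[X]`
(`exists_limit_functional`). Its GNS representation has a unit vector `Ω`. For `t` close to 1, `⟨Ω,
ΔΩ⟩` is small, and the spectral gap puts `Ω` close to some `w` in the kernel of `Δ`
(`exists_kernel_approximation`). Such a `w` is fixed by every element with row sums 1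
(`map_eq_self_of_map_roeLaplacian`), in particular by the projection `A` averaging over large cells.
But `t ^ d` decays, so `AΩ` is small when the cells are large. Then `w = AΩ - A(Ω - w)` is small and
also close to the unit vector `Ω`, a contradiction (`not_tendsto_detourEdges_of_spectral_gap`). -/

/-! ### The GNS construction for `*`-algebras -/

section GNS

open UniformSpace ContinuousLinearMap

/-- A positive functional on a `*`-algebra for which left multiplications are bounded. -/
structure BoundedPositiveFunctional (A : Type u) [Ring A] [StarRing A] [Algebra ℂ A] where
  toLin : A →ₗ[ℂ] ℂ
  map_star : ∀ a, toLin (star a) = star (toLin a)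
  nonneg : ∀ a, 0 ≤ (toLin (star a * a)).re
  bounded : ∀ a, ∃ C : ℝ, 0 ≤ C ∧
    ∀ b, (toLin (star (a * b) * (a * b))).re ≤ C ^ 2 * (toLin (star b * b)).re

namespace BoundedPositiveFunctional

variable {A : Type u} [Ring A] [StarRing A] [Algebra ℂ A]

set_option linter.unusedVariables false in
/-- The algebra, as the pre-Hilbert space of the functional `f`. -/
def PreGNS (f : BoundedPositiveFunctional A) : Type u := A

variable (f : BoundedPositiveFunctional A)

instance : AddCommGroup f.PreGNS := inferInstanceAs (AddCommGroup A)
instance : Module ℂ f.PreGNS := inferInstanceAs (Module ℂ A)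

/-- The identity map from the algebra to its pre-Hilbert space. -/
def toPreGNS : A ≃ₗ[ℂ] f.PreGNS := LinearEquiv.refl ℂ _

variable [StarModule ℂ A]

/-- The semi-inner product `⟨a, b⟩ = f (a⋆ b)`. -/
noncomputable abbrev preCore : PreInnerProductSpace.Core ℂ f.PreGNS where
  inner a b := f.toLin (star (f.toPreGNS.symm a) * f.toPreGNS.symm b)
  conj_inner_symm a b := by
    rw [← Complex.star_def, ← f.map_star, star_mul, star_star]
  re_inner_nonneg a := f.nonneg _
  add_left _ _ _ := by rw [map_add, star_add, add_mul, map_add]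
  smul_left a b c := by simp

/-- Only a seminorm: null vectors of `f` are not quotiented out by hand, because the completion,
being separated, identifies them with zero. -/
noncomputable instance : SeminormedAddCommGroup f.PreGNS :=
  InnerProductSpace.Core.toSeminormedAddCommGroup (c := f.preCore)
noncomputable instance : InnerProductSpace ℂ f.PreGNS :=
  InnerProductSpace.ofCore f.preCore

theorem preGNS_inner (a b : A) :
    inner ℂ (f.toPreGNS a) (f.toPreGNS b) = f.toLin (star a * b) := rfl

theorem preGNS_norm_sq (a : A) : ‖f.toPreGNS a‖ ^ 2 = (f.toLin (star a * a)).re := by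
  rw [← preGNS_inner, ← inner_self_eq_norm_sq (𝕜 := ℂ)]
  rfl

/-- Left multiplication on the pre-Hilbert space. -/
noncomputable def leftMul (a : A) : f.PreGNS →L[ℂ] f.PreGNS :=
  LinearMap.mkContinuous
    (f.toPreGNS.toLinearMap ∘ₗ LinearMap.mulLeft ℂ a ∘ₗ f.toPreGNS.symm.toLinearMap)
    (f.bounded a).choose fun x => by
      obtain ⟨h0, h⟩ := (f.bounded a).choose_spec
      have hx := h (f.toPreGNS.symm x)
      rw [← preGNS_norm_sq, ← preGNS_norm_sq, ← mul_pow] at hx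
      exact (abs_le_of_sq_le_sq' hx (by positivity)).2

@[simp]
theorem leftMul_apply (a b : A) : f.leftMul a (f.toPreGNS b) = f.toPreGNS (a * b) := rfl

theorem completion_induction {p : Completion f.PreGNS → Prop} (hp : IsClosed {x | p x})
    (h : ∀ a : A, p (f.toPreGNS a : f.PreGNS)) (x : Completion f.PreGNS) : p x :=
  Completion.induction_on x hp fun a => h (f.toPreGNS.symm a)

/-- The GNS representation. -/
noncomputable def gns : A →⋆ₐ[ℂ] (Completion f.PreGNS →L[ℂ] Completion f.PreGNS) where
  toFun a := (f.leftMul a).completion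
  map_one' := by
    ext x
    induction x using f.completion_induction with
    | hp => apply isClosed_eq <;> fun_prop
    | h a => simp
  map_mul' a b := by
    ext x
    induction x using f.completion_induction with
    | hp => apply isClosed_eq <;> fun_prop
    | h c => simp [mul_assoc]
  map_zero' := by
    ext x
    induction x using f.completion_induction with
    | hp => apply isClosed_eq <;> fun_prop
    | h c => simp [Completion.coe_zero]
  map_add' a b := by
    ext x
    induction x using f.completion_induction with
    | hp => apply isClosed_eq <;> fun_prop
    | h c => simp [add_mul, Completion.coe_add]
  commutes' r := by
    ext x
    induction x using f.completion_induction with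
    | hp => apply isClosed_eq <;> fun_prop
    | h c => simp [Algebra.algebraMap_eq_smul_one, Completion.coe_smul]
  map_star' a := by
    refine (eq_adjoint_iff _ _).mpr fun x y => ?_
    induction x using f.completion_induction with
    | hp => apply isClosed_eq <;> fun_prop
    | h b =>
      induction y using f.completion_induction with
      | hp => apply isClosed_eq <;> fun_prop
      | h c => simp [preGNS_inner, mul_assoc]

theorem gns_inner (a : A) :
    inner ℂ ((f.toPreGNS 1 : f.PreGNS) : Completion f.PreGNS) (f.gns a (f.toPreGNS 1 : f.PreGNS)) =
      f.toLin a := by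
  change inner ℂ _ ((f.leftMul a).completion _) = _
  simp [preGNS_inner]

end BoundedPositiveFunctional

end GNS

/-! ### Spectral gaps -/

section SpectralGap

variable {H : Type*} [NormedAddCommGroup H] [InnerProductSpace ℂ H] [CompleteSpace H]

/-- A self-adjoint operator with spectrum in `{0} ∪ [γ, ∞)` moves vectors away from its kernel. -/
theorem exists_kernel_approximation (D : H →L[ℂ] H) (hD : IsSelfAdjoint D) {γ : ℝ} (hγ : 0 < γ)
    (hspec : spectrum ℂ D ⊆ {0} ∪ Complex.ofReal '' Set.Ici γ) (v : H) :
    ∃ w : H, D w = 0 ∧ γ * ‖v - w‖ ^ 2 ≤ (inner ℂ v (D v)).re := by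
  have hs : ∀ x ∈ spectrum ℝ D, x = 0 ∨ γ ≤ x := by
    intro x hx
    have hx' : (algebraMap ℝ ℂ x) ∈ spectrum ℂ D := (spectrum.algebraMap_mem_iff ℂ).2 hx
    rcases hspec hx' with h | ⟨y, hy, h⟩
    · left
      simpa using h
    · right
      have : y = x := by simpa using h
      exact this ▸ hy
  -- On the spectrum this continuous function is the indicator of 0, so `P` below is a projection
  -- with `D * P = 0`.
  let g : ℝ → ℝ := fun x => max (1 - x / γ) 0
  have hg : Continuous g := by fun_prop
  have hg0 : g 0 = 1 := by simp [g]
  have hg1 : ∀ x, γ ≤ x → g x = 0 := fun x hx => by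
    have : 1 ≤ x / γ := (one_le_div hγ).2 hx
    simp [g, this]
  let P := cfc g D
  have hP : IsSelfAdjoint P := cfc_predicate g D
  have hDP : D * P = 0 := by
    have h1 : D * P = cfc (fun x => x * g x) D := by
      rw [cfc_mul (fun x => x) g D continuousOn_id hg.continuousOn, cfc_id' ℝ D]
    rw [h1, cfc_congr (g := fun _ => 0) (fun x hx => ?_), cfc_const_zero]
    rcases hs x hx with rfl | h
    · simp
    · simp [hg1 x h]
  have hPP : P * P = P := by
    rw [← cfc_mul g g D hg.continuousOn hg.continuousOn]
    refine cfc_congr fun x hx => ?_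
    rcases hs x hx with rfl | h
    · simp [hg0]
    · simp [hg1 x h]
  -- The radicand is nonnegative on the spectrum: 0 at 0 and `x - γ` beyond the gap. So `D - γ(1 -
  -- P)` is the square of the self-adjoint `B`, and pairing with `v` gives `⟨v, Dv⟩ = ‖Bv‖² + γ‖v -
  -- Pv‖²`.
  let q : ℝ → ℝ := fun x => √(x - γ * (1 - g x))
  have hq : Continuous q :=
    Real.continuous_sqrt.comp (continuous_id.sub (continuous_const.mul (continuous_const.sub hg)))
  let B := cfc q D
  have hB : IsSelfAdjoint B := cfc_predicate q D
  have hBB : B * B = D - γ • (1 - P) := by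
    have h1 : D - γ • (1 - P) = cfc (fun x => x - γ * (1 - g x)) D := by
      have hg' : Continuous fun x => 1 - g x := continuous_const.sub hg
      rw [cfc_sub (fun x => x) (fun x => γ * (1 - g x)) D continuousOn_id
          (continuous_const.mul hg').continuousOn, cfc_id' ℝ D,
        cfc_const_mul γ (fun x => 1 - g x) D hg'.continuousOn,
        cfc_sub (fun _ => 1) g D continuousOn_const hg.continuousOn, cfc_const_one ℝ D]
    rw [h1, ← cfc_mul q q D hq.continuousOn hq.continuousOn]
    refine cfc_congr fun x hx => Real.mul_self_sqrt ?_
    rcases hs x hx with rfl | h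
    · simp [hg0]
    · simp only [hg1 x h]
      linarith
  have hsq : ∀ (T : H →L[ℂ] H), IsSelfAdjoint T → (inner ℂ v ((T * T) v)).re = ‖T v‖ ^ 2 := by
    intro T hT
    have := ContinuousLinearMap.adjoint_inner_right T v (T v)
    rw [← ContinuousLinearMap.star_eq_adjoint, hT.star_eq] at this
    rw [mul_apply_eq_comp, this, ← inner_self_eq_norm_sq (𝕜 := ℂ)]
    rfl
  have hQ : (1 - P) * (1 - P) = 1 - P := by
    rw [mul_sub, sub_mul, sub_mul, hPP]
    simp
  refine ⟨P v, by rw [← mul_apply_eq_comp, hDP]; simp, ?_⟩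
  have h1 := hsq B hB
  have h2 := hsq (1 - P) ((IsSelfAdjoint.one _).sub hP)
  rw [hBB] at h1
  rw [hQ] at h2
  have h3 : (inner ℂ v ((D - γ • (1 - P)) v)).re =
      (inner ℂ v (D v)).re - γ * (inner ℂ v ((1 - P) v)).re := by
    simp [inner_sub_right, inner_smul_right_eq_smul, mul_sub]
  rw [h3, h2] at h1
  have h4 : (1 - P) v = v - P v := by simp
  rw [h4] at h1
  nlinarith [sq_nonneg ‖B v‖]

end SpectralGap

/-! ### From the maximal algebra to a single representation. -/

section Extension

variable {V : ℕ → Type u} [∀ n, Fintype (V n)] [∀ n, DecidableEq (V n)]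

/-- The spectrum in a representation is contained in the spectrum in the maximal algebra. -/
theorem spectrum_representation_subset (X : ∀ n, SimpleGraph (V n)) [UniformlyBoundedDegree X]
    (π : RoeRepresentation X) (T : AlgebraicRoe X) :
    spectrum ℂ (π.hom T) ⊆ spectrum ℂ (T : MaxRoe X) := by
  have hlip : Continuous (π.hom : AlgebraicRoe X → (π.H →L[ℂ] π.H)) :=
    AddMonoidHomClass.continuous_of_bound π.hom 1 fun S => by
      rw [one_mul]
      exact representation_norm_le_maxNorm X π S
  -- Every representation is contractive for the maximal norm and extends to the completion; a
  -- unital ring homomorphism preserves invertibility of `c - T`.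
  let E : MaxRoe X →+* (π.H →L[ℂ] π.H) :=
    UniformSpace.Completion.extensionHom (π.hom : AlgebraicRoe X →+* (π.H →L[ℂ] π.H)) hlip
  have hE : ∀ S : AlgebraicRoe X, E (S : MaxRoe X) = π.hom S := fun S =>
    UniformSpace.Completion.extensionHom_coe _ hlip S
  intro c hc
  rw [spectrum.mem_iff] at hc ⊢
  intro hu
  apply hc
  have h := hu.map E
  rw [map_sub, hE, UniformSpace.Completion.algebraMap_def, hE, AlgHomClass.commutes] at h
  exact h

end Extension

/-! ### Independent sets -/

/-- A finite digraph of out-degree at most `k` has an independent set of proportion `1 / (2k+1)`. -/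
theorem exists_independent_subset {α : Type*} [DecidableEq α] (C : α → Finset α) (k : ℕ)
    (hC : ∀ e, (C e).card ≤ k) (F : Finset α) :
    ∃ E ⊆ F, (∀ e ∈ E, ∀ f ∈ E, e ≠ f → f ∉ C e) ∧ F.card ≤ (2 * k + 1) * E.card := by
  induction F using Finset.strongInduction with
  | H F ih =>
    rcases F.eq_empty_or_nonempty with rfl | hF
    · exact ⟨∅, by simp⟩
    -- Double counting: in-degrees within `F` sum to at most `k` times the size of `F`, so some `e`
    -- has in-degree at most `k`. Removing `e` with its in- and out-neighbours costs at most `2k +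
    -- 1` elements.
    have hsum : ∑ e ∈ F, (F.filter fun f => e ∈ C f).card ≤ ∑ e ∈ F, k := by
      simp only [Finset.card_filter]
      rw [Finset.sum_comm]
      refine Finset.sum_le_sum fun f _ => ?_
      rw [← Finset.card_filter]
      exact (Finset.card_le_card fun x hx => (Finset.mem_filter.1 hx).2).trans (hC f)
    obtain ⟨e, heF, he⟩ := Finset.exists_le_of_sum_le hF hsum
    let B := insert e (C e ∪ F.filter fun f => e ∈ C f)
    have hB : B.card ≤ 2 * k + 1 := by
      have h1 := Finset.card_insert_le e (C e ∪ F.filter fun f => e ∈ C f)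
      have h2 := Finset.card_union_le (C e) (F.filter fun f => e ∈ C f)
      have h3 := hC e
      change (insert e (C e ∪ F.filter fun f => e ∈ C f)).card ≤ _
      omega
    have heB : e ∈ B := Finset.mem_insert_self _ _
    obtain ⟨E, hEF, hE, hcard⟩ := ih (F \ B)
      ((Finset.ssubset_iff_of_subset Finset.sdiff_subset).2
        ⟨e, heF, fun h => (Finset.mem_sdiff.1 h).2 heB⟩)
    have hnot : ∀ f ∈ E, f ∈ F ∧ f ≠ e ∧ f ∉ C e ∧ e ∉ C f := by
      intro f hf
      have h1 := Finset.mem_sdiff.1 (hEF hf)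
      have h2 := h1.2
      simp only [B, Finset.mem_insert, Finset.mem_union, Finset.mem_filter, not_or] at h2
      exact ⟨h1.1, h2.1, h2.2.1, fun h => h2.2.2 ⟨h1.1, h⟩⟩
    refine ⟨insert e E, ?_, ?_, ?_⟩
    · intro f hf
      rcases Finset.mem_insert.1 hf with rfl | hf
      · exact heF
      · exact (hnot f hf).1
    · intro f hf g hg hfg
      rcases Finset.mem_insert.1 hf with hf' | hf' <;> rcases Finset.mem_insert.1 hg with hg' | hg'
      · exact absurd (hf'.trans hg'.symm) hfg
      · exact hf' ▸ (hnot g hg').2.2.1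
      · exact hg' ▸ (hnot f hf').2.2.2
      · exact hE f hf' g hg' hfg
    · rw [Finset.card_insert_of_notMem fun h => (hnot e h).2.1 rfl]
      have h1 : F.card ≤ (F \ B).card + B.card := by
        rw [← Finset.card_union_of_disjoint Finset.sdiff_disjoint]
        exact Finset.card_le_card fun x hx => by
          by_cases h : x ∈ B <;> simp [h, hx]
      rw [mul_add, mul_one]
      omega

/-! ### Edges with short detours -/

namespace SimpleGraph

variable {W : Type*}

/-- The edges of `G` whose end points are joined by a walk of length at most `k` that avoids them. -/
def detourEdges (G : SimpleGraph W) (k : ℕ) : Set (Sym2 W) :=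
  {e | e ∈ G.edgeSet ∧ ∃ (x y : W) (p : G.Walk x y), e = s(x, y) ∧ e ∉ p.edges ∧ p.length ≤ k}

theorem exists_walk_le_mul_length {G H : SimpleGraph W} {k : ℕ}
    (h : ∀ x y, G.Adj x y → ∃ q : H.Walk x y, q.length ≤ k) {x y : W} (p : G.Walk x y) :
    ∃ q : H.Walk x y, q.length ≤ k * p.length := by
  induction p with
  | nil => exact ⟨Walk.nil, by simp⟩
  | cons hadj p ih =>
    obtain ⟨q, hq⟩ := ih
    obtain ⟨r, hr⟩ := h _ _ hadj
    refine ⟨r.append q, ?_⟩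
    rw [Walk.length_append, Walk.length_cons, mul_add, mul_one]
    omega

/-- Deleting edges that have short detours avoiding all deleted edges distorts distances by a
bounded factor. -/
theorem connected_and_dist_le_of_deleteEdges {G : SimpleGraph W} (hG : G.Connected)
    (E : Set (Sym2 W)) {k : ℕ} (hk : 1 ≤ k)
    (hE : ∀ e ∈ E, ∃ (x y : W) (p : G.Walk x y), e = s(x, y) ∧ (∀ f ∈ p.edges, f ∉ E) ∧
      p.length ≤ k) :
    (G.deleteEdges E).Connected ∧ ∀ x y, (G.deleteEdges E).dist x y ≤ k * G.dist x y := by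
  have key : ∀ x y, G.Adj x y → ∃ q : (G.deleteEdges E).Walk x y, q.length ≤ k := by
    intro x y hxy
    by_cases h : s(x, y) ∈ E
    · obtain ⟨a, b, p, hab, hp, hlen⟩ := hE _ h
      have hl : (p.toDeleteEdges E hp).length ≤ k := by simpa using hlen
      rcases Sym2.eq_iff.1 hab with ⟨rfl, rfl⟩ | ⟨rfl, rfl⟩
      · exact ⟨_, hl⟩
      · exact ⟨(p.toDeleteEdges E hp).reverse, by rw [Walk.length_reverse]; exact hl⟩
    · exact ⟨Walk.cons (by rw [deleteEdges_adj]; exact ⟨hxy, h⟩) Walk.nil, by simpa using hk⟩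
  have := hG.nonempty
  refine ⟨⟨fun x y => ?_⟩, fun x y => ?_⟩
  · obtain ⟨p⟩ := hG.preconnected x y
    obtain ⟨q, -⟩ := exists_walk_le_mul_length key p
    exact ⟨q⟩
  · obtain ⟨p, hp⟩ := hG.exists_walk_length_eq_dist x y
    obtain ⟨q, hq⟩ := exists_walk_le_mul_length key p
    rw [← hp]
    exact (dist_le q).trans hq

theorem ncard_edgeSet_deleteEdges [Finite W] (G : SimpleGraph W) {E : Set (Sym2 W)}
    (hE : E ⊆ G.edgeSet) : (G.deleteEdges E).edgeSet.ncard + E.ncard = G.edgeSet.ncard := by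
  rw [edgeSet_deleteEdges]
  exact Set.ncard_sdiff_add_ncard_of_subset hE

/-- A positive proportion of the edges with short detours can be removed without changing the
coarse structure. -/
theorem exists_sparser_of_detourEdges [Finite W] {G : SimpleGraph W} (hG : G.Connected) {k : ℕ}
    (hk : 1 ≤ k) :
    ∃ H ≤ G, H.Connected ∧ (∀ x y, H.dist x y ≤ k * G.dist x y) ∧
      (G.detourEdges k).ncard + (2 * k + 1) * H.edgeSet.ncard ≤ (2 * k + 1) * G.edgeSet.ncard := by
  classical
  have hF : ∀ e ∈ G.detourEdges k, ∃ C : Finset (Sym2 W), C.card ≤ k ∧ e ∉ C ∧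
      ∃ (x y : W) (p : G.Walk x y), e = s(x, y) ∧ (∀ f ∈ p.edges, f ∈ C) ∧ p.length ≤ k := by
    rintro e ⟨-, x, y, p, he, hp, hlen⟩
    refine ⟨p.edges.toFinset, ?_, by simpa using hp, x, y, p, he, by simp, hlen⟩
    exact (List.toFinset_card_le _).trans (by rwa [Walk.length_edges])
  have hC : ∀ e, ∃ C : Finset (Sym2 W), C.card ≤ k ∧ (e ∈ G.detourEdges k → e ∉ C ∧
      ∃ (x y : W) (p : G.Walk x y), e = s(x, y) ∧ (∀ f ∈ p.edges, f ∈ C) ∧ p.length ≤ k) := by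
    intro e
    by_cases he : e ∈ G.detourEdges k
    · obtain ⟨C, h1, h2⟩ := hF e he
      exact ⟨C, h1, fun _ => h2⟩
    · exact ⟨∅, by simp, fun h => absurd h he⟩
  choose C hCk hCe using hC
  have hfin : (G.detourEdges k).Finite := Set.toFinite _
  obtain ⟨E, hEF, hE, hcard⟩ := exists_independent_subset C k hCk hfin.toFinset
  have hEF' : ∀ e ∈ E, e ∈ G.detourEdges k := fun e he => hfin.mem_toFinset.1 (hEF he)
  -- Independence of `E` says exactly that the chosen detour of a deleted edge contains no other
  -- deleted edge.
  obtain ⟨h1, h2⟩ := connected_and_dist_le_of_deleteEdges hG (E : Set (Sym2 W)) hk (by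
    intro e he
    obtain ⟨h0, x, y, p, hxy, hp, hlen⟩ := hCe e (hEF' e he)
    refine ⟨x, y, p, hxy, fun f hf hfE => ?_, hlen⟩
    by_cases hef : e = f
    · exact h0 (hef ▸ hp f hf)
    · exact hE e he f hfE hef (hp f hf))
  refine ⟨G.deleteEdges E, deleteEdges_le _, h1, h2, ?_⟩
  have h3 := ncard_edgeSet_deleteEdges G (E := (E : Set (Sym2 W))) fun e he => (hEF' e he).1
  rw [Set.ncard_coe_finset] at h3
  rw [Set.ncard_eq_toFinset_card _ hfin, ← h3, mul_add]
  omega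

/-- The detour leaves `a` along an edge other than `e`, and cannot arrive in a single step. This
supplies `d ≥ 2` and `k ≥ 2` for the comparison of `2k + 1` with `d ^ k`; for `k = 2` the detour
closes a triangle. -/
theorem exists_two_neighbors_of_mem_detourEdges {G : SimpleGraph W} {k : ℕ} {e : Sym2 W}
    (he : e ∈ G.detourEdges k) :
    2 ≤ k ∧ ∃ a b c, e = s(a, b) ∧ G.Adj a b ∧ G.Adj a c ∧ b ≠ c ∧ (k = 2 → G.Adj c b) := by
  obtain ⟨hadj, x, y, p, rfl, hp, hlen⟩ := he
  have hxy : G.Adj x y := hadj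
  cases p with
  | nil => exact absurd rfl hxy.ne
  | cons h q =>
    rename_i c
    cases q with
    | nil => simp at hp
    | cons h' r =>
      simp only [Walk.length_cons] at hlen
      have hyc : y ≠ c := by
        rintro rfl
        simp at hp
      refine ⟨by omega, x, y, c, rfl, hxy, h, hyc, fun hk => ?_⟩
      cases r with
      | nil => exact h'
      | cons h'' r => simp only [Walk.length_cons] at hlen; omega

/-- In a connected graph of degree at most `2`, a triangle is everything. -/
theorem ncard_edgeSet_le_three_of_triangle [Finite W] {G : SimpleGraph W} (hG : G.Connected)
    (hdeg : ∀ x, (G.neighborSet x).ncard ≤ 2) {a b c : W} (hab : G.Adj a b) (hac : G.Adj a c)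
    (hcb : G.Adj c b) : G.edgeSet.ncard ≤ 3 := by
  classical
  have hpair : ∀ x y z w, G.Adj x y → G.Adj x z → y ≠ z → G.Adj x w → w = y ∨ w = z := by
    intro x y z w hy hz hyz hw
    by_contra! hcon
    have h1 : ({y, z, w} : Set W) ⊆ G.neighborSet x := by
      rintro v (rfl | rfl | rfl) <;> assumption
    have h2 := Set.ncard_le_ncard h1
    rw [Set.ncard_eq_three.2 ⟨y, z, w, hyz, hcon.1.symm, hcon.2.symm, rfl⟩] at h2
    have := hdeg x
    omega
  have hclosed : ∀ x y, G.Adj x y → (x = a ∨ x = b ∨ x = c) → (y = a ∨ y = b ∨ y = c) := by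
    rintro x y hxy (rfl | rfl | rfl)
    · rcases hpair x b c y hab hac hcb.ne.symm hxy with h | h <;> simp [h]
    · rcases hpair x a c y hab.symm hcb.symm hac.ne hxy with h | h <;> simp [h]
    · rcases hpair x a b y hac.symm hcb hab.ne hxy with h | h <;> simp [h]
  have hall : ∀ x, x = a ∨ x = b ∨ x = c := by
    intro x
    obtain ⟨p⟩ := hG.preconnected a x
    have : ∀ {u v : W} (_ : G.Walk u v), (u = a ∨ u = b ∨ u = c) → (v = a ∨ v = b ∨ v = c) := by
      intro u v p
      induction p with
      | nil => exact id
      | cons h _ ih => exact fun hu => ih (hclosed _ _ h hu)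
    exact this p (Or.inl rfl)
  have hsub : G.edgeSet ⊆ ({s(a, b), s(a, c), s(c, b)} : Finset (Sym2 W)) := by
    intro e he
    induction e with
    | h x y =>
      have hxy : G.Adj x y := he
      have hne := hxy.ne
      rcases hall x with rfl | rfl | rfl <;> rcases hall y with rfl | rfl | rfl <;>
        first
          | exact absurd rfl hne
          | simp [Sym2.eq_swap]
  refine (Set.ncard_le_ncard hsub (Set.toFinite _)).trans ?_
  rw [Set.ncard_coe_finset]
  exact Finset.card_le_three

/-- Converts the constant of the independent set into the power of the degree in the statement. The
excluded case is a true exception, `5 > 4`, and is treated separately. -/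
theorem two_mul_add_one_le_pow {d k : ℕ} (hd : 2 ≤ d) (hk : 2 ≤ k) (h : d ≠ 2 ∨ k ≠ 2) :
    2 * k + 1 ≤ d ^ k := by
  rcases h with h | h
  · have h3 : 3 ^ k ≤ d ^ k := Nat.pow_le_pow_left (by omega) k
    refine le_trans ?_ h3
    clear h3 h hk
    induction k with
    | zero => simp
    | succ k ih => rw [pow_succ]; omega
  · have h3 : 2 ^ k ≤ d ^ k := Nat.pow_le_pow_left (by omega) k
    refine le_trans ?_ h3
    obtain ⟨j, rfl⟩ : ∃ j, k = j + 3 := ⟨k - 3, by omega⟩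
    clear h3 h hk
    induction j with
    | zero => simp
    | succ j ih => rw [show j + 1 + 3 = (j + 3) + 1 by ring, pow_succ]; omega

/-- The removal of edges with detours, with a constant in terms of the degree. -/
theorem exists_sparser_of_degree_le [Finite W] {G : SimpleGraph W} (hG : G.Connected) {d k : ℕ}
    (hdeg : ∀ x, (G.neighborSet x).ncard ≤ d) (hne : (G.detourEdges k).Nonempty) :
    ∃ H ≤ G, H.Connected ∧ (∀ x y, H.dist x y ≤ k * G.dist x y) ∧
      (G.detourEdges k).ncard + d ^ k * H.edgeSet.ncard ≤ d ^ k * G.edgeSet.ncard := by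
  obtain ⟨e, he⟩ := hne
  obtain ⟨hk, a, b, c, rfl, hab, hac, hbc, hcb⟩ := exists_two_neighbors_of_mem_detourEdges he
  have hd : 2 ≤ d := by
    have h1 : ({b, c} : Set W) ⊆ G.neighborSet a := by
      rintro v (rfl | rfl) <;> assumption
    have h2 := Set.ncard_le_ncard h1 (Set.toFinite _)
    rw [Set.ncard_pair hbc] at h2
    exact h2.trans (hdeg a)
  by_cases hdk : d ≠ 2 ∨ k ≠ 2
  · obtain ⟨H, h1, h2, h3, h4⟩ := exists_sparser_of_detourEdges hG (k := k) (by omega)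
    refine ⟨H, h1, h2, h3, ?_⟩
    have h5 := two_mul_add_one_le_pow hd hk hdk
    have h6 : H.edgeSet.ncard ≤ G.edgeSet.ncard :=
      Set.ncard_le_ncard (edgeSet_mono h1) (Set.toFinite _)
    obtain ⟨m, hm⟩ := Nat.exists_eq_add_of_le h6
    rw [hm] at h4 ⊢
    nlinarith
  -- For `d = k = 2` the whole graph is a triangle with at most three edges; deleting a single edge
  -- already gains `4 ≥ 3`.
  · push Not at hdk
    obtain ⟨rfl, rfl⟩ := hdk
    obtain ⟨-, x, y, p, hxy, hp, hlen⟩ := he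
    obtain ⟨h1, h2⟩ := connected_and_dist_le_of_deleteEdges hG {s(a, b)} (k := 2) (by omega) (by
      rintro e rfl
      exact ⟨x, y, p, hxy, fun f hf hfe => hp (hfe ▸ hf), hlen⟩)
    refine ⟨G.deleteEdges {s(a, b)}, deleteEdges_le _, h1, h2, ?_⟩
    have h3 := ncard_edgeSet_deleteEdges G (E := {s(a, b)}) (by simpa using hab)
    rw [Set.ncard_singleton] at h3
    have h4 : (G.detourEdges 2).ncard ≤ G.edgeSet.ncard :=
      Set.ncard_le_ncard (fun e he => he.1) (Set.toFinite _)
    have h5 := ncard_edgeSet_le_three_of_triangle hG hdeg hab hac (hcb rfl)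
    omega

theorem Walk.exists_eq_append_cons_of_mem_darts {G : SimpleGraph W} {x y : W} (p : G.Walk x y)
    (e : G.Dart) (he : e ∈ p.darts) :
    ∃ (q : G.Walk x e.fst) (r : G.Walk e.snd y), p = q.append (Walk.cons e.adj r) := by
  induction p with
  | nil => simp at he
  | cons h p ih =>
    rw [Walk.darts_cons, List.mem_cons] at he
    rcases he with rfl | he
    · exact ⟨Walk.nil, p, rfl⟩
    · obtain ⟨q, r, hqr⟩ := ih he
      exact ⟨Walk.cons h q, r, by rw [Walk.cons_append, ← hqr]⟩

/-- The rest of the cycle, read from the end of the edge round to its start, is the detour; it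
avoids the edge because a cycle is a trail. -/
theorem Walk.IsCycle.edge_mem_detourEdges {G : SimpleGraph W} {x : W} {p : G.Walk x x}
    (hp : p.IsCycle) {R : ℕ} (hR : p.length ≤ R) {e : G.Dart} (he : e ∈ p.darts) :
    e.edge ∈ G.detourEdges (R - 1) := by
  obtain ⟨q, r, hqr⟩ := p.exists_eq_append_cons_of_mem_darts e he
  have htrail := hp.isTrail.edges_nodup
  rw [hqr] at hR htrail
  rw [Walk.edges_append, Walk.edges_cons] at htrail
  rw [Walk.length_append, Walk.length_cons] at hR
  refine ⟨e.edge_mem, e.snd, e.fst, r.append q, ?_, ?_, ?_⟩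
  · rw [Sym2.eq_swap]
    rfl
  · rw [Walk.edges_append, List.mem_append]
    have := List.nodup_middle.1 htrail
    rw [List.nodup_cons, List.mem_append] at this
    exact fun h => this.1 h.symm
  · rw [Walk.length_append]
    omega

end SimpleGraph

theorem finrank_shortCycleSpace_le {W : Type u} [Finite W] (G : SimpleGraph W) (R : ℕ) :
    Module.finrank ℝ (shortCycleSpace G R) ≤ (G.detourEdges (R - 1)).ncard := by
  classical
  -- One arbitrary orientation per edge is enough for spanning, since the opposite one differs by a
  -- sign.
  let b : Sym2 W → ((W × W) →₀ ℝ) := fun e => orientedEdge e.out.1 e.out.2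
  have hfin : (G.detourEdges (R - 1)).Finite := Set.toFinite _
  let S : Finset ((W × W) →₀ ℝ) := hfin.toFinset.image b
  have hsub : shortCycleSpace G R ≤ Submodule.span ℝ (S : Set ((W × W) →₀ ℝ)) := by
    refine Submodule.span_le.2 ?_
    rintro z ⟨x, p, hp, hlen, rfl⟩
    refine list_sum_mem fun z hz => ?_
    obtain ⟨e, he, rfl⟩ := List.mem_map.1 hz
    have hmem : b e.edge ∈ Submodule.span ℝ (S : Set ((W × W) →₀ ℝ)) := by
      refine Submodule.subset_span (Finset.mem_coe.2 (Finset.mem_image_of_mem b ?_))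
      exact hfin.mem_toFinset.2 (hp.edge_mem_detourEdges hlen he)
    have hout : s(e.edge.out.1, e.edge.out.2) = s(e.fst, e.snd) := Quot.out_eq e.edge
    rcases Sym2.eq_iff.1 hout with ⟨h1, h2⟩ | ⟨h1, h2⟩
    · simpa [b, h1, h2] using hmem
    · have : orientedEdge e.fst e.snd = - b e.edge := by
        simp only [b, h1, h2, orientedEdge, neg_sub]
      rw [this]
      exact Submodule.neg_mem _ hmem
  refine (Submodule.finrank_mono hsub).trans ((finrank_span_finset_le_card S).trans ?_)
  rw [Set.ncard_eq_toFinset_card _ hfin]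
  exact Finset.card_image_le

/-! ### Comparison of costs -/

section Cost

variable {V : ℕ → Type u}

/-- No upper bound is assumed: in the unbounded case the real `sSup` defaults to 0. This is
convenient because it bounds the set defining the cost from below without any degree bound on its
members. -/
theorem liminf_nonneg_of_nonneg {v : ℕ → ℝ} (hv : ∀ n, 0 ≤ v n) : 0 ≤ liminf v atTop := by
  rw [liminf_eq]
  by_cases h : BddAbove {a | ∀ᶠ n in atTop, a ≤ v n}
  · exact le_csSup h (Eventually.of_forall hv)
  · rw [Real.sSup_of_not_bddAbove h]

theorem liminf_le_liminf_sub {v w : ℕ → ℝ} {B δ : ℝ} (hv : ∀ n, 0 ≤ v n) (hw : ∀ n, 0 ≤ w n)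
    (hB : ∀ n, w n ≤ B) (h : ∀ᶠ n in atTop, v n ≤ w n - δ) :
    liminf v atTop ≤ liminf w atTop - δ := by
  have h1 : IsBoundedUnder (· ≥ ·) atTop w := isBoundedUnder_of ⟨0, hw⟩
  have h2 : IsBoundedUnder (· ≤ ·) atTop w := isBoundedUnder_of ⟨B, hB⟩
  have h3 : IsBoundedUnder (· ≤ ·) atTop (fun n => w n - δ) :=
    isBoundedUnder_of ⟨B - δ, fun n => sub_le_sub_right (hB n) δ⟩
  have h4 : liminf (fun n => w n - δ) atTop = liminf w atTop - δ := by
    simp only [sub_eq_add_neg]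
    exact liminf_add_const atTop w (-δ) h2.isCoboundedUnder_ge h1
  rw [← h4]
  exact liminf_le_liminf h (isBoundedUnder_of ⟨0, hv⟩) h3.isCoboundedUnder_ge

theorem ncard_edgeSet_le_mul_card {W : Type*} [Fintype W] (G : SimpleGraph W) {d : ℕ}
    (h : ∀ x, (G.neighborSet x).ncard ≤ d) : G.edgeSet.ncard ≤ d * Fintype.card W := by
  classical
  have h1 := G.sum_degrees_eq_twice_card_edges
  have h2 : ∑ x, G.degree x ≤ ∑ _x : W, d := Finset.sum_le_sum fun x _ => by
    have := h x
    rwa [Set.ncard_eq_toFinset_card'] at this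
  rw [h1] at h2
  have h3 : G.edgeSet.ncard = G.edgeFinset.card := Set.ncard_eq_toFinset_card' _
  simp only [Finset.sum_const, Finset.card_univ, smul_eq_mul] at h2
  rw [mul_comm] at h2
  rw [h3, mul_comm]
  rw [mul_comm] at h2
  omega

theorem SameCoarseStructure.exists_nat {X Y : ∀ n, SimpleGraph (V n)}
    (h : SameCoarseStructure X Y) : ∃ L : ℕ, ∀ n (x y : V n),
      (X n).dist x y ≤ L * (Y n).dist x y ∧ (Y n).dist x y ≤ L * (X n).dist x y := by
  obtain ⟨-, -, L, hL⟩ := h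
  obtain ⟨M, hM⟩ := exists_nat_ge L
  refine ⟨M, fun n x y => ⟨?_, ?_⟩⟩
  · have := (hL n x y).1.trans (mul_le_mul_of_nonneg_right hM (Nat.cast_nonneg _))
    exact_mod_cast this
  · have := (hL n x y).2.trans (mul_le_mul_of_nonneg_right hM (Nat.cast_nonneg _))
    exact_mod_cast this

theorem SameCoarseStructure.refl {X : ∀ n, SimpleGraph (V n)} (h : ∀ n, (X n).Connected) :
    SameCoarseStructure X X :=
  ⟨h, h, 1, fun n x y => by simp⟩

theorem SameCoarseStructure.trans {X Y Z : ∀ n, SimpleGraph (V n)} (h₁ : SameCoarseStructure X Y)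
    (h₂ : SameCoarseStructure Y Z) : SameCoarseStructure X Z := by
  obtain ⟨L, hL⟩ := h₁.exists_nat
  obtain ⟨M, hM⟩ := h₂.exists_nat
  refine ⟨h₁.1, h₂.2.1, (L * M : ℕ), fun n x y => ⟨?_, ?_⟩⟩
  · have := (hL n x y).1.trans (Nat.mul_le_mul_left L (hM n x y).1)
    rw [← mul_assoc] at this
    exact_mod_cast this
  · have := (hM n x y).2.trans (Nat.mul_le_mul_left M (hL n x y).2)
    rw [← mul_assoc, mul_comm M] at this
    exact_mod_cast this

/-- Balls in a sequence that is coarsely equivalent to one of bounded degree are bounded. -/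
theorem SameCoarseStructure.exists_ball_bound [∀ n, Fintype (V n)] {X Y : ∀ n, SimpleGraph (V n)}
    [UniformlyBoundedDegree X] (h : SameCoarseStructure X Y) (r : ℕ) :
    ∃ N : ℕ, ∀ n (x : V n), {y | (Y n).dist x y ≤ r}.ncard ≤ N := by
  obtain ⟨L, hL⟩ := h.exists_nat
  obtain ⟨N, hN⟩ := _root_.exists_ball_bound X (L * r)
  refine ⟨N, fun n x => (Set.ncard_le_ncard (fun y hy => ?_) (Set.toFinite _)).trans (hN n x)⟩
  have h1 : (X n).dist x y ≤ L * r := (hL n x y).1.trans (Nat.mul_le_mul_left L hy)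
  have h2 := (h.1 n).preconnected x y
  change (X n).edist x y ≤ _
  rw [← h2.coe_dist_eq_edist]
  exact_mod_cast h1

theorem SameCoarseStructure.exists_degree_bound [∀ n, Fintype (V n)]
    {X Y : ∀ n, SimpleGraph (V n)} [UniformlyBoundedDegree X] (h : SameCoarseStructure X Y) :
    ∃ d : ℕ, DegreeAtMost Y d := by
  obtain ⟨N, hN⟩ := h.exists_ball_bound 1
  refine ⟨N, fun n x => (Set.ncard_le_ncard (fun y hy => ?_) (Set.toFinite _)).trans (hN n x)⟩
  exact (SimpleGraph.dist_eq_one_iff_adj.2 hy).le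

variable [∀ n, Fintype (V n)]

theorem combinatorialCost_le {X Y : ∀ n, SimpleGraph (V n)} (h : SameCoarseStructure X Y) :
    combinatorialCost X ≤ liminfEdgeDensity Y := by
  refine csInf_le ⟨0, ?_⟩ ⟨Y, h, rfl⟩
  rintro _ ⟨Z, -, rfl⟩
  exact liminf_nonneg_of_nonneg fun n => by positivity

/-- Edges with short detours make the cost drop. -/
theorem combinatorialCost_le_sub {X Y : ∀ n, SimpleGraph (V n)} (h : SameCoarseStructure X Y)
    {d k : ℕ} (hd : DegreeAtMost Y d) {ε : ℝ} (hε : 0 < ε)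
    (hF : ∀ᶠ n in atTop, ε * (Fintype.card (V n) : ℝ) ≤ (((Y n).detourEdges k).ncard : ℝ)) :
    combinatorialCost X ≤ liminfEdgeDensity Y - ε / (d : ℝ) ^ k := by
  have hpos : ∀ n, 0 < (Fintype.card (V n) : ℝ) := fun n => by
    have := (h.1 n).nonempty
    exact_mod_cast Fintype.card_pos
  -- Where the density bound fails, `Y n` is kept. The factor `k + 1` instead of `k` covers this
  -- case too, as it is at least 1 even for `k = 0`.
  have hex : ∀ n, ∃ H ≤ Y n, H.Connected ∧
      (∀ x y, H.dist x y ≤ (k + 1) * (Y n).dist x y) ∧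
      (ε * (Fintype.card (V n) : ℝ) ≤ (((Y n).detourEdges k).ncard : ℝ) →
        ((Y n).detourEdges k).ncard + d ^ k * H.edgeSet.ncard ≤ d ^ k * (Y n).edgeSet.ncard) := by
    intro n
    by_cases hn : ε * (Fintype.card (V n) : ℝ) ≤ (((Y n).detourEdges k).ncard : ℝ)
    · have hne : ((Y n).detourEdges k).Nonempty := by
        rw [← Set.ncard_pos (Set.toFinite _)]
        have := (mul_pos hε (hpos n)).trans_le hn
        exact_mod_cast this
      obtain ⟨H, h1, h2, h3, h4⟩ := SimpleGraph.exists_sparser_of_degree_le (h.2.1 n) (hd n) hne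
      exact ⟨H, h1, h2, fun x y => (h3 x y).trans (Nat.mul_le_mul_right _ (Nat.le_succ k)),
        fun _ => h4⟩
    · refine ⟨Y n, le_rfl, h.2.1 n, fun x y => ?_, fun h' => absurd h' hn⟩
      exact Nat.le_mul_of_pos_left _ (Nat.succ_pos k)
  choose Z hZY hZ hdist hcard using hex
  have hYZ : SameCoarseStructure Y Z := by
    refine ⟨h.2.1, hZ, (k + 1 : ℕ), fun n x y => ⟨?_, ?_⟩⟩
    · have h1 : (Y n).dist x y ≤ (Z n).dist x y :=
        ((hZ n).preconnected x y).dist_anti (hZY n)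
      have h2 : (Y n).dist x y ≤ (k + 1) * (Z n).dist x y :=
        h1.trans (Nat.le_mul_of_pos_left _ (Nat.succ_pos k))
      exact_mod_cast h2
    · exact_mod_cast hdist n x y
  refine (combinatorialCost_le (h.trans hYZ)).trans ?_
  refine liminf_le_liminf_sub (B := d) (fun n => by positivity) (fun n => by positivity) ?_ ?_
  · intro n
    rw [div_le_iff₀ (hpos n)]
    exact_mod_cast ncard_edgeSet_le_mul_card (Y n) (hd n)
  · filter_upwards [hF] with n hn
    have h1 : (((Y n).detourEdges k).ncard : ℝ) + (d : ℝ) ^ k * ((Z n).edgeSet.ncard : ℝ) ≤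
        (d : ℝ) ^ k * ((Y n).edgeSet.ncard : ℝ) := by exact_mod_cast hcard n hn
    have h2 : 0 < ε * (Fintype.card (V n) : ℝ) := mul_pos hε (hpos n)
    -- If the power vanished, `h1` would leave no detour edges, against `hn`.
    have h3 : 0 < (d : ℝ) ^ k := by
      refine lt_of_le_of_ne (by positivity) fun h0 => ?_
      rw [← h0] at h1
      linarith
    rw [le_sub_iff_add_le, div_add_div _ _ (hpos n).ne' h3.ne', div_le_div_iff₀
      (mul_pos (hpos n) h3) (hpos n)]
    have h4 := mul_le_mul_of_nonneg_right (add_le_add hn (le_refl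
      ((d : ℝ) ^ k * ((Z n).edgeSet.ncard : ℝ)))) (hpos n).le
    have h5 := mul_le_mul_of_nonneg_right h1 (hpos n).le
    nlinarith

/-- The cost of a sequence with many short cycles. -/
theorem combinatorialCost_le_of_shortCycleSpace {X : ∀ n, SimpleGraph (V n)}
    (hconn : ∀ n, (X n).Connected) {d : ℕ} (hd : DegreeAtMost X d) {R : ℕ} {ε : ℝ} (hε : 0 < ε)
    (hZ : ∀ n, ε * (Fintype.card (V n) : ℝ) ≤
      (Module.finrank ℝ (shortCycleSpace (X n) R) : ℝ)) :
    combinatorialCost X ≤ liminfEdgeDensity X - ε / (d : ℝ) ^ (R - 1) := by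
  refine combinatorialCost_le_sub (SameCoarseStructure.refl hconn) hd hε (Eventually.of_forall ?_)
  intro n
  exact (hZ n).trans (by exact_mod_cast finrank_shortCycleSpace_le (X n) R)

end Cost

/-! ### The exponential of the distance on tree-like balls -/

namespace SimpleGraph

variable {W : Type*} {G : SimpleGraph W}

theorem dist_lt_of_mem_support_geodesic {x y z : W} (p : G.Walk x z) (hp : p.length = G.dist x z)
    (hy : y ∈ p.support) (hyx : y ≠ x) : G.dist y z < G.dist x z := by
  classical
  have h1 : (p.takeUntil y hy).length + (p.dropUntil y hy).length = p.length := by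
    rw [← Walk.length_append, Walk.take_spec]
  have h2 : (p.takeUntil y hy).length ≠ 0 := fun h => hyx (Walk.eq_of_length_eq_zero h).symm
  have h3 := dist_le (p.dropUntil y hy)
  omega

/-- Run a geodesic from `x` to `z` and one back to `y`. Past its start a geodesic gets strictly
closer to `z`, so neither contains the other end point, and hence neither uses the edge. -/
theorem mem_detourEdges_of_dist_eq (hG : G.Connected) {x y z : W} {r : ℕ} (hxy : G.Adj x y)
    (hx : G.dist x z ≤ r) (h : G.dist x z = G.dist y z) : s(x, y) ∈ G.detourEdges (2 * r) := by
  obtain ⟨p, hp⟩ := hG.exists_walk_length_eq_dist x z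
  obtain ⟨q, hq⟩ := hG.exists_walk_length_eq_dist y z
  refine ⟨hxy, x, y, p.append q.reverse, rfl, ?_, ?_⟩
  · rw [Walk.edges_append, List.mem_append, Walk.edges_reverse, List.mem_reverse, not_or]
    constructor
    · intro he
      have := dist_lt_of_mem_support_geodesic p hp (Walk.snd_mem_support_of_mem_edges p he)
        hxy.ne.symm
      omega
    · intro he
      have := dist_lt_of_mem_support_geodesic q hq (Walk.fst_mem_support_of_mem_edges q he) hxy.ne
      omega
  · rw [Walk.length_append, Walk.length_reverse]
    omega

/-- The detour goes from `x` to `v`, down to `z` and up to `u`. Both geodesics stay strictly closer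
to `z` than `x`, so `x` is visited only at the start; the length is `2 d(x, z) - 1`. -/
theorem mem_detourEdges_of_two_parents (hG : G.Connected) {x u v z : W} {r : ℕ} (hxu : G.Adj x u)
    (hxv : G.Adj x v) (huv : u ≠ v) (hx : G.dist x z ≤ r) (hu : G.dist u z + 1 = G.dist x z)
    (hv : G.dist v z + 1 = G.dist x z) : s(x, u) ∈ G.detourEdges (2 * r) := by
  obtain ⟨p, hp⟩ := hG.exists_walk_length_eq_dist v z
  obtain ⟨q, hq⟩ := hG.exists_walk_length_eq_dist u z
  refine ⟨hxu, x, u, (Walk.cons hxv p).append q.reverse, rfl, ?_, ?_⟩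
  · rw [Walk.edges_append, List.mem_append, Walk.edges_reverse, List.mem_reverse, not_or,
      Walk.edges_cons, List.mem_cons, not_or]
    refine ⟨⟨?_, ?_⟩, ?_⟩
    · intro h
      rcases Sym2.eq_iff.1 h with ⟨-, h⟩ | ⟨h, -⟩
      · exact huv h
      · exact hxv.ne h
    · intro he
      have := dist_lt_of_mem_support_geodesic p hp (Walk.fst_mem_support_of_mem_edges p he) hxv.ne
      omega
    · intro he
      have := dist_lt_of_mem_support_geodesic q hq (Walk.fst_mem_support_of_mem_edges q he) hxu.ne
      omega
  · rw [Walk.length_append, Walk.length_reverse, Walk.length_cons]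
    omega

/-- The root is its own parent, so with truncated subtraction the distance formula holds everywhere
and the parent map can be iterated freely. -/
theorem exists_parent (hG : G.Connected) (z x : W) :
    ∃ y, G.dist y z = G.dist x z - 1 ∧ (x = z → y = z) ∧ (x ≠ z → G.Adj x y) := by
  by_cases hxz : x = z
  · exact ⟨z, by simp [hxz], fun _ => rfl, fun h => absurd hxz h⟩
  obtain ⟨p, hp⟩ := hG.exists_walk_length_eq_dist x z
  cases p with
  | nil => exact absurd rfl hxz
  | cons h q =>
    rename_i y
    refine ⟨y, ?_, fun h => absurd h hxz, fun _ => h⟩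
    rw [Walk.length_cons] at hp
    have h1 := dist_le q
    have h2 : G.dist x z ≤ G.dist x y + G.dist y z := hG.dist_triangle
    rw [dist_eq_one_iff_adj.2 h] at h2
    omega

/-- Around `z`, up to distance `r`, the graph is a tree in which `par` sends a vertex to its
neighbour on the way to `z`. -/
structure IsTreeLike (G : SimpleGraph W) (z : W) (r : ℕ) (par : W → W) : Prop where
  dist_par : ∀ x, G.dist (par x) z = G.dist x z - 1
  par_root : par z = z
  adj_par : ∀ x, x ≠ z → G.Adj x (par x)
  par_or_par : ∀ x y, G.Adj x y → G.dist x z ≤ r → G.dist y z ≤ r → par x = y ∨ par y = x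

/-- Without short detours, no edge joins two vertices at the same distance from `z`, and no vertex
has two neighbours closer to `z`; so every edge joins a vertex to its parent. -/
theorem exists_isTreeLike (hG : G.Connected) {z : W} {r : ℕ}
    (h : ∀ x y, G.dist x z ≤ r → s(x, y) ∉ G.detourEdges (2 * r)) :
    ∃ par, G.IsTreeLike z r par := by
  choose par h1 h2 h3 using exists_parent hG z
  refine ⟨par, h1, h2 z rfl, h3, ?_⟩
  have key : ∀ x y, G.Adj x y → G.dist x z ≤ r → G.dist y z < G.dist x z → par x = y := by
    intro x y hxy hx hlt
    by_contra hne
    have hxz : x ≠ z := by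
      rintro rfl
      simp at hlt
    have h4 : G.dist x z ≤ G.dist x y + G.dist y z := hG.dist_triangle
    rw [dist_eq_one_iff_adj.2 hxy] at h4
    have h5 := h1 x
    exact h x (par x) hx (mem_detourEdges_of_two_parents hG (h3 x hxz) hxy hne hx
      (by omega) (by omega))
  intro x y hxy hx hy
  rcases lt_trichotomy (G.dist x z) (G.dist y z) with hlt | heq | hlt
  · exact Or.inr (key y x hxy.symm hy hlt)
  · exact absurd (mem_detourEdges_of_dist_eq hG hxy hx heq) (h x y hx)
  · exact Or.inl (key x y hxy hx hlt)

namespace IsTreeLike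

variable {z : W} {r : ℕ} {par : W → W}

theorem dist_iterate (h : G.IsTreeLike z r par) (i : ℕ) (x : W) :
    G.dist (par^[i] x) z = G.dist x z - i := by
  induction i generalizing x with
  | zero => simp
  | succ i ih =>
    rw [Function.iterate_succ_apply, ih, h.dist_par]
    omega

/-- The vertices with `x` among their iterated parents form the branch at `x`. Inside the tree-like
ball the only way out of the branch is the edge from `x` to `par x`, so the walk takes that step and
then still has to reach `y`. -/
theorem dist_par_lt_length (h : G.IsTreeLike z r par) {x w y : W} (p : G.Walk w y)
    (hp : ∀ v ∈ p.support, G.dist v z ≤ r) (hw : ∃ i, par^[i] w = x)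
    (hy : ¬ ∃ i, par^[i] y = x) : G.dist (par x) y + 1 ≤ p.length := by
  induction p with
  | nil => exact absurd hw hy
  | cons hadj q ih =>
    rename_i w w' y
    rw [Walk.length_cons]
    have hq : ∀ v ∈ q.support, G.dist v z ≤ r := fun v hv =>
      hp v (by rw [Walk.support_cons]; exact List.mem_cons_of_mem _ hv)
    by_cases hw' : ∃ i, par^[i] w' = x
    · exact (ih hq hw' hy).trans (Nat.le_succ _)
    · rcases h.par_or_par w w' hadj (hp w (Walk.start_mem_support _))
        (hq w' (Walk.start_mem_support _)) with hpar | hpar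
      · obtain ⟨i, hi⟩ := hw
        cases i with
        | zero =>
          have hi' : w = x := hi
          rw [← hi', hpar]
          exact Nat.succ_le_succ (dist_le q)
        | succ i =>
          rw [Function.iterate_succ_apply, hpar] at hi
          exact absurd ⟨i, hi⟩ hw'
      · obtain ⟨i, hi⟩ := hw
        exact absurd ⟨i + 1, by rw [Function.iterate_succ_apply, hpar, hi]⟩ hw'

/-- A vertex `y` no farther from the root than `x` and different from it is outside the branch at
`x`, so a geodesic passes through `par x`. Geodesics between points of the `s`-ball have length at
most `2s`, so they stay in the `3s`-ball: hence the factor 3. -/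
theorem dist_eq_dist_par_add_one {s : ℕ} (hs : 3 * s ≤ r) (hG : G.Connected)
    (h : G.IsTreeLike z r par) {x y : W} (hxy : x ≠ y) (hle : G.dist y z ≤ G.dist x z)
    (hx : G.dist x z ≤ s) : G.dist x y = G.dist (par x) y + 1 := by
  classical
  have hxz : x ≠ z := by
    rintro rfl
    rw [dist_self, Nat.le_zero, hG.dist_eq_zero_iff] at hle
    exact hxy hle.symm
  apply le_antisymm
  · have h1 : G.dist x y ≤ G.dist x (par x) + G.dist (par x) y := hG.dist_triangle
    rw [dist_eq_one_iff_adj.2 (h.adj_par x hxz)] at h1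
    omega
  · obtain ⟨p, hp⟩ := hG.exists_walk_length_eq_dist x y
    rw [← hp]
    refine h.dist_par_lt_length p (fun v hv => ?_) ⟨0, rfl⟩ ?_
    · have h1 : G.dist x y ≤ G.dist x z + G.dist z y := hG.dist_triangle
      rw [G.dist_comm (u := z)] at h1
      have h2 : G.dist v z ≤ G.dist v x + G.dist x z := hG.dist_triangle
      rw [G.dist_comm (u := v) (v := x)] at h2
      have h3 := (dist_le (p.takeUntil v hv)).trans (p.length_takeUntil_le_length hv)
      omega
    · rintro ⟨i, hi⟩
      have h1 := h.dist_iterate i y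
      rw [hi] at h1
      have h2 : G.dist x z ≠ 0 := fun h0 => hxz (hG.dist_eq_zero_iff.1 h0)
      have h3 : i = 0 := by omega
      subst h3
      exact hxy hi.symm

variable [DecidableEq W]

/-- Vectors attached to the vertices, by recursion on the distance to the root. -/
noncomputable def vec (par : W → W) (t : ℝ) : ℕ → W → W → ℝ
  | 0, x => Pi.single x 1
  | n + 1, x => t • vec par t n (par x) + √(1 - t ^ 2) • Pi.single x 1

/-- The vector of `x` is supported on the path from `x` to the root, where all vertices except `x`
are strictly closer to the root. -/
theorem vec_eq_zero (h : G.IsTreeLike z r par) (t : ℝ) {n : ℕ} {x u : W} (hx : G.dist x z = n)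
    (hux : u ≠ x) (hu : G.dist x z ≤ G.dist u z) : vec par t n x u = 0 := by
  induction n generalizing x with
  | zero => simp [vec, hux]
  | succ n ih =>
    have h1 := h.dist_par x
    have h2 : u ≠ par x := by
      rintro rfl
      omega
    simp [vec, hux, ih (x := par x) (by omega) h2 (by omega)]

/-- Induction on the total distance to the root, moving the farther vertex `x` to its parent. For `y
≠ x` the new coordinate at `x` is orthogonal to the vector of `y`, so the product is multiplied by
`t`, just as the distance grows by one. For `y = x` one gets `t² + (1 - t²) = 1`. -/
theorem sum_vec_mul_vec [Fintype W] {s : ℕ} (hs : 3 * s ≤ r) (hG : G.Connected)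
    (h : G.IsTreeLike z r par) {t : ℝ} (ht : t ^ 2 ≤ 1) (x y : W) (hx : G.dist x z ≤ s)
    (hy : G.dist y z ≤ s) :
    ∑ u, vec par t (G.dist x z) x u * vec par t (G.dist y z) y u = t ^ G.dist x y := by
  obtain ⟨N, hN⟩ : ∃ N, G.dist x z + G.dist y z = N := ⟨_, rfl⟩
  induction N using Nat.strong_induction_on generalizing x y with
  | _ N ih =>
    wlog hle : G.dist y z ≤ G.dist x z generalizing x y with H
    · have := H y x hy hx (by omega) (by omega)
      rw [G.dist_comm (u := x) (v := y), ← this]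
      exact Finset.sum_congr rfl fun u _ => mul_comm _ _
    rcases hn : G.dist x z with _ | n
    · have hx0 : x = z := hG.dist_eq_zero_iff.1 hn
      have hy0 : y = z := hG.dist_eq_zero_iff.1 (by omega)
      subst hx0
      subst hy0
      simp [vec, Pi.single_apply]
    · have hpar : G.dist (par x) z = n := by
        rw [h.dist_par, hn]
        rfl
      by_cases hxy : x = y
      · subst hxy
        have h1 := ih (n + n) (by omega) (par x) (par x) (by omega) (by omega) (by omega)
        rw [hpar, dist_self, pow_zero] at h1
        have h2 : vec par t n (par x) x = 0 := by
          refine h.vec_eq_zero t hpar ?_ (by omega)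
          intro h0
          rw [← h0] at hpar
          omega
        rw [hn]
        have h3 : ∀ u, vec par t (n + 1) x u * vec par t (n + 1) x u =
            t ^ 2 * (vec par t n (par x) u * vec par t n (par x) u) +
            (Pi.single x (2 * t * √(1 - t ^ 2) * vec par t n (par x) x + √(1 - t ^ 2) ^ 2) :
              W → ℝ) u := by
          intro u
          by_cases hu : u = x
          · subst hu
            simp only [vec, Pi.add_apply, Pi.smul_apply, Pi.single_eq_same, smul_eq_mul]
            ring
          · simp only [vec, Pi.add_apply, Pi.smul_apply, Pi.single_eq_of_ne hu, smul_eq_mul]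
            ring
        rw [Finset.sum_congr rfl fun u _ => h3 u, Finset.sum_add_distrib, ← Finset.mul_sum, h1,
          Finset.sum_pi_single', h2, Real.sq_sqrt (by linarith)]
        simp
      · have h1 := ih (n + G.dist y z) (by omega) (par x) y (by omega) hy (by omega)
        rw [hpar] at h1
        have h2 : vec par t (G.dist y z) y x = 0 := h.vec_eq_zero t rfl hxy hle
        have h3 : ∀ u, vec par t (n + 1) x u * vec par t (G.dist y z) y u =
            t * (vec par t n (par x) u * vec par t (G.dist y z) y u) := by
          intro u
          by_cases hu : u = x
          · subst hu
            simp [h2]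
          · simp only [vec, Pi.add_apply, Pi.smul_apply, Pi.single_eq_of_ne hu, smul_eq_mul]
            ring
        rw [Finset.sum_congr rfl fun u _ => h3 u, ← Finset.mul_sum, h1,
          h.dist_eq_dist_par_add_one hs hG hxy hle hx, pow_succ]
        ring

end IsTreeLike

/-- The kernel `t ^ d(x, y)` is positive definite on balls without short detours. -/
theorem re_sum_pow_dist_nonneg [Fintype W] (hG : G.Connected) {z : W} {s : ℕ}
    (h : ∀ x y, G.dist x z ≤ 3 * s → s(x, y) ∉ G.detourEdges (2 * (3 * s))) {t : ℝ}
    (ht : t ^ 2 ≤ 1) (a : W → ℂ) (ha : ∀ x, a x ≠ 0 → G.dist x z ≤ s) :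
    0 ≤ (∑ x, ∑ y, star (a x) * a y * ((t ^ G.dist x y : ℝ) : ℂ)).re := by
  classical
  obtain ⟨par, hpar⟩ := exists_isTreeLike hG h
  -- Gram vectors of the kernel on the ball: the double sum becomes the sum over `u` of `|∑ a x · ξ
  -- x u|²`.
  let ξ : W → W → ℝ := fun x => IsTreeLike.vec par t (G.dist x z) x
  have h1 : ∀ x y, star (a x) * a y * ((t ^ G.dist x y : ℝ) : ℂ) =
      ∑ u, star (a x * (ξ x u : ℂ)) * (a y * (ξ y u : ℂ)) := by
    intro x y
    by_cases hx : a x = 0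
    · simp [hx]
    by_cases hy : a y = 0
    · simp [hy]
    rw [← hpar.sum_vec_mul_vec le_rfl hG ht x y (ha x hx) (ha y hy), Complex.ofReal_sum,
      Finset.mul_sum]
    refine Finset.sum_congr rfl fun u _ => ?_
    rw [star_mul', Complex.star_def, Complex.conj_ofReal]
    simp only [ξ]
    push_cast
    ring
  have h2 : ∑ x, ∑ y, star (a x) * a y * ((t ^ G.dist x y : ℝ) : ℂ) =
      ∑ u, ((‖∑ x, a x * (ξ x u : ℂ)‖ ^ 2 : ℝ) : ℂ) := by
    simp only [h1]
    calc _ = ∑ x, ∑ u, ∑ y, star (a x * (ξ x u : ℂ)) * (a y * (ξ y u : ℂ)) :=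
          Finset.sum_congr rfl fun x _ => Finset.sum_comm
      _ = ∑ u, ∑ x, ∑ y, star (a x * (ξ x u : ℂ)) * (a y * (ξ y u : ℂ)) := Finset.sum_comm
      _ = _ := Finset.sum_congr rfl fun u _ => by
          rw [← Finset.sum_mul_sum, ← star_sum, Complex.star_def, Complex.conj_mul']
          simp
  rw [h2, ← Complex.ofReal_sum, Complex.ofReal_re]
  exact Finset.sum_nonneg fun u _ => sq_nonneg _

end SimpleGraph

/-! ### Elements of the algebraic uniform Roe algebra -/

/-- The balls of radius `R` can be enumerated by finitely many maps of bounded displacement. -/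
theorem exists_ball_enumeration {V : ℕ → Type u} [∀ n, Fintype (V n)]
    (X : ∀ n, SimpleGraph (V n)) [UniformlyBoundedDegree X] (R : ℕ) :
    ∃ (N : ℕ) (e : ℕ → ∀ n, V n → V n) (v : ℕ → ∀ n, V n → ℂ),
      (∀ k n x, (X n).edist x (e k n x) ≤ R) ∧
      (∀ k n x, v k n x = 1 ∨ v k n x = 0 ∧ e k n x = x) ∧
      (∀ n x y, (X n).edist x y ≤ R → ∃ k < N, e k n x = y) ∧
      ∀ n x (f : V n → ℂ), (∀ y, f y ≠ 0 → (X n).edist x y ≤ R) →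
        ∑ k ∈ Finset.range N, v k n x * f (e k n x) = ∑ y, f y := by
  classical
  obtain ⟨N, hN⟩ := exists_ball_bound X R
  let B : ∀ n, V n → Finset (V n) := fun n x => Finset.univ.filter fun y => (X n).edist x y ≤ R
  have hB : ∀ n x, (B n x).card ≤ N := fun n x => by
    refine le_trans (le_of_eq ?_) (hN n x)
    rw [Set.ncard_eq_toFinset_card']
    congr 1
    ext y
    simp [B]
  have hmem : ∀ n x y, y ∈ B n x ↔ (X n).edist x y ≤ R := fun n x y => by simp [B]
  -- Balls smaller than `N` are padded: surplus indices send `x` to itself with weight 0, so the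
  -- weighted sum counts each point of the ball once.
  let e : ℕ → ∀ n, V n → V n := fun k n x =>
    if h : k < (B n x).card then ((B n x).equivFin.symm ⟨k, h⟩ : V n) else x
  let v : ℕ → ∀ n, V n → ℂ := fun k n x => if k < (B n x).card then 1 else 0
  refine ⟨N, e, v, fun k n x => ?_, fun k n x => ?_, fun n x y hy => ?_, fun n x f hf => ?_⟩
  · by_cases h : k < (B n x).card
    · simp only [e, dif_pos h]
      exact (hmem n x _).1 (Subtype.prop _)
    · simp [e, h]
  · by_cases h : k < (B n x).card
    · left
      simp [v, h]
    · right
      simp [v, e, h]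
  · have hy' := (hmem n x y).2 hy
    refine ⟨(B n x).equivFin ⟨y, hy'⟩, (Fin.is_lt _).trans_le (hB n x), ?_⟩
    simp [e]
  · have h1 : ∑ y, f y = ∑ y ∈ B n x, f y := by
      refine (Finset.sum_subset (Finset.subset_univ _) fun y _ hy => ?_).symm
      by_contra h
      exact hy ((hmem n x y).2 (hf y h))
    have h2 : ∑ k ∈ Finset.range N, v k n x * f (e k n x) =
        ∑ k ∈ Finset.range (B n x).card, v k n x * f (e k n x) := by
      refine (Finset.sum_subset (Finset.range_mono (hB n x)) fun k _ hk => ?_).symm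
      simp only [Finset.mem_range] at hk
      simp [v, hk]
    rw [h1, h2, Finset.sum_range, ← Finset.sum_coe_sort (B n x)]
    refine Fintype.sum_equiv (B n x).equivFin.symm _ _ fun k => ?_
    simp [v, e]

section RoeElements

variable {V : ℕ → Type u} [∀ n, Fintype (V n)] [∀ n, DecidableEq (V n)]
variable {X : ∀ n, SimpleGraph (V n)}

instance : StarModule ℂ (AlgebraicRoe X) := inferInstanceAs (StarModule ℂ (roeSubalgebra X))

/-- The sequence of matrices underlying an element of `ℂ_cs[X]`. -/
def AlgebraicRoe.entries :
    AlgebraicRoe X →⋆ₐ[ℂ] (∀ n, Matrix (V n) (V n) ℂ) := (roeSubalgebra X).subtype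

theorem AlgebraicRoe.ext {S T : AlgebraicRoe X}
    (h : ∀ n x y, S.entries n x y = T.entries n x y) : S = T :=
  Subtype.ext (funext fun n => Matrix.ext fun x y => h n x y)

theorem entries_mul (S T : AlgebraicRoe X) (n : ℕ) (x y : V n) :
    (S * T).entries n x y = ∑ z, S.entries n x z * T.entries n z y := by
  rw [map_mul, Pi.mul_apply, Matrix.mul_apply]

theorem entries_star (S : AlgebraicRoe X) (n : ℕ) (x y : V n) :
    (star S).entries n x y = star (S.entries n y x) := by
  rw [map_star, Pi.star_apply, Matrix.star_apply]

theorem entries_sum {ι : Type*} (s : Finset ι) (S : ι → AlgebraicRoe X) (n : ℕ) (x y : V n) :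
    (∑ i ∈ s, S i).entries n x y = ∑ i ∈ s, (S i).entries n x y := by
  rw [map_sum, Finset.sum_apply, Matrix.sum_apply]

theorem entries_one (n : ℕ) (x y : V n) :
    (1 : AlgebraicRoe X).entries n x y = if x = y then 1 else 0 := by
  rw [map_one, Pi.one_apply, Matrix.one_apply]

theorem entries_sub (S T : AlgebraicRoe X) (n : ℕ) (x y : V n) :
    (S - T).entries n x y = S.entries n x y - T.entries n x y := by
  rw [map_sub, Pi.sub_apply, Matrix.sub_apply]

theorem entries_smul (c : ℂ) (T : AlgebraicRoe X) (n : ℕ) (x y : V n) :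
    (c • T).entries n x y = c * T.entries n x y := by
  rw [map_smul, Pi.smul_apply, Matrix.smul_apply, smul_eq_mul]

theorem norm_sq_eq_re_inner_star_mul {H : Type*} [NormedAddCommGroup H] [InnerProductSpace ℂ H]
    [CompleteSpace H] (π : AlgebraicRoe X →⋆ₐ[ℂ] (H →L[ℂ] H)) (S : AlgebraicRoe X) (w : H) :
    ‖π S w‖ ^ 2 = (inner ℂ w (π (star S * S) w)).re := by
  rw [map_mul, map_star, mul_apply_eq_comp, ContinuousLinearMap.star_eq_adjoint,
    ContinuousLinearMap.adjoint_inner_right, ← inner_self_eq_norm_sq (𝕜 := ℂ)]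
  rfl

theorem norm_entries_le (T : AlgebraicRoe X) : ∃ M : ℝ, ∀ n x y, ‖T.entries n x y‖ ≤ M := by
  obtain ⟨T, ⟨C, hC⟩, hT⟩ := T
  refine ⟨C, fun n x y => ?_⟩
  have h1 := (Matrix.toEuclideanCLM (𝕜 := ℂ) (T n)).le_opNorm (EuclideanSpace.single y 1)
  rw [PiLp.norm_single, norm_one, mul_one] at h1
  have h2 := PiLp.norm_apply_le
    (Matrix.toEuclideanCLM (𝕜 := ℂ) (T n) (EuclideanSpace.single y 1)) x
  have h3 : Matrix.toEuclideanCLM (𝕜 := ℂ) (T n) (EuclideanSpace.single y 1) x = T n x y := by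
    rw [Matrix.ofLp_toEuclideanCLM]
    simp
  rw [h3] at h2
  exact h2.trans (h1.trans (hC n))

theorem finitePropagation_entries (T : AlgebraicRoe X) : FinitePropagation X T.entries := T.2.2

variable (X)

/-- The displacement of a self-map of the vertex sets is bounded. -/
abbrev BoundedDisplacement (b : ∀ n, V n → V n) : Prop :=
  ∃ R : ℕ, ∀ n x, (X n).edist x (b n x) ≤ R

variable [UniformlyBoundedDegree X]

/-- Composition with a self-map of bounded displacement. -/
noncomputable def roeMap (b : ∀ n, V n → V n) (hb : BoundedDisplacement X b) : AlgebraicRoe X :=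
  ⟨fun n => Matrix.of fun x y => if y = b n x then 1 else 0, by
    obtain ⟨R, hR⟩ := hb
    refine mem_roeSubalgebra_of_entries X _ ⟨R, fun n x y h => ?_⟩ 1 fun n x y => ?_
    · have hy : y = b n x := by
        by_contra hy
        exact h (by simp [hy])
      rw [hy]
      exact hR n x
    · rw [Matrix.of_apply]
      split_ifs <;> simp⟩

/-- Multiplication by a bounded function. -/
noncomputable def roeDiag (w : ∀ n, V n → ℂ) (hw : ∃ M : ℝ, ∀ n x, ‖w n x‖ ≤ M) :
    AlgebraicRoe X :=
  ⟨fun n => Matrix.diagonal (w n), by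
    obtain ⟨M, hM⟩ := hw
    refine mem_roeSubalgebra_of_entries X _ ⟨0, fun n x y h => ?_⟩ M fun n x y => ?_
    · have hxy : x = y := by
        by_contra hxy
        exact h (Matrix.diagonal_apply_ne _ hxy)
      simp [hxy]
    · by_cases hxy : x = y
      · subst hxy
        simpa using hM n x
      · rw [Matrix.diagonal_apply_ne _ hxy, norm_zero]
        exact (norm_nonneg _).trans (hM n x)⟩

variable {X}

theorem roeMap_entries (b : ∀ n, V n → V n) (hb : BoundedDisplacement X b) (n : ℕ) (x y : V n) :
    (roeMap X b hb).entries n x y = if y = b n x then 1 else 0 := rfl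

theorem roeDiag_entries (w : ∀ n, V n → ℂ) (hw : ∃ M : ℝ, ∀ n x, ‖w n x‖ ≤ M) (n : ℕ)
    (x y : V n) : (roeDiag X w hw).entries n x y = if x = y then w n x else 0 :=
  Matrix.diagonal_apply _ _ _

theorem roeDiag_mul_entries (w : ∀ n, V n → ℂ) (hw : ∃ M : ℝ, ∀ n x, ‖w n x‖ ≤ M)
    (T : AlgebraicRoe X) (n : ℕ) (x y : V n) :
    (roeDiag X w hw * T).entries n x y = w n x * T.entries n x y := by
  simp [entries_mul, roeDiag_entries]

theorem roeMap_mul_entries (b : ∀ n, V n → V n) (hb : BoundedDisplacement X b)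
    (T : AlgebraicRoe X) (n : ℕ) (x y : V n) :
    (roeMap X b hb * T).entries n x y = T.entries n (b n x) y := by
  simp [entries_mul, roeMap_entries]


open Classical in
theorem roeLaplacian_entries (n : ℕ) (x y : V n) :
    (roeLaplacian X).entries n x y =
      (if x = y then ((X n).degree x : ℂ) else 0) - if (X n).Adj x y then 1 else 0 := by
  have h : (roeLaplacian X).entries n x y = (X n).lapMatrix ℂ x y := rfl
  rw [h, SimpleGraph.lapMatrix, Matrix.sub_apply, SimpleGraph.degMatrix,
    SimpleGraph.adjMatrix_apply, Matrix.diagonal_apply]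

theorem star_roeLaplacian : star (roeLaplacian X) = roeLaplacian X := by
  classical
  refine AlgebraicRoe.ext fun n x y => ?_
  rw [entries_star, roeLaplacian_entries, roeLaplacian_entries, (X n).adj_comm y x]
  by_cases hxy : x = y
  · subst hxy
    simp
  · simp [hxy, Ne.symm hxy, apply_ite star]

/-- The Laplacian is a sum of squares of differences along maps of displacement one. -/
theorem sum_star_mul_eq_roeLaplacian (N : ℕ) (e : ℕ → ∀ n, V n → V n) (v : ℕ → ∀ n, V n → ℂ)
    (he : ∀ k n x, (X n).edist x (e k n x) ≤ (1 : ℕ))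
    (hv : ∀ k n x, v k n x = 1 ∨ v k n x = 0 ∧ e k n x = x)
    (hsum : ∀ n x (f : V n → ℂ), (∀ y, f y ≠ 0 → (X n).edist x y ≤ (1 : ℕ)) →
        ∑ k ∈ Finset.range N, v k n x * f (e k n x) = ∑ y, f y) :
    ∑ k ∈ Finset.range N, star (1 - roeMap X (e k) ⟨1, he k⟩) * (1 - roeMap X (e k) ⟨1, he k⟩) =
      (2 : ℂ) • roeLaplacian X := by
  classical
  refine AlgebraicRoe.ext fun n u w => ?_
  rw [entries_sum, entries_smul]
  simp only [entries_mul, entries_star, entries_sub, entries_one]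
  rw [Finset.sum_comm]
  -- The `(u, w)` entry contributed by the difference along the ordered pair `(x, y)`. It vanishes
  -- on the diagonal, so padding is harmless; each edge occurs in both orders, whence the factor 2.
  let g : V n → V n → ℂ := fun x y =>
    star ((if x = u then 1 else 0) - (if u = y then 1 else 0) : ℂ) *
      ((if x = w then 1 else 0) - (if w = y then 1 else 0))
  have hg : ∀ x, g x x = 0 := fun x => by simp [g, eq_comm (a := u)]
  have h1 : ∀ x, ∑ k ∈ Finset.range N, g x (e k n x) =
      ∑ y, if (X n).Adj x y then g x y else 0 := by
    intro x
    rw [← hsum n x]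
    · refine Finset.sum_congr rfl fun k _ => ?_
      by_cases hadj : (X n).Adj x (e k n x)
      · rcases hv k n x with h | ⟨-, h⟩
        · rw [h, if_pos hadj, one_mul]
        · exact absurd h.symm hadj.ne
      · have h := he k n x
        rw [Nat.cast_one, SimpleGraph.edist_le_one_iff_adj_or_eq] at h
        rw [if_neg hadj, mul_zero, ← h.resolve_left hadj, hg]
    · intro y hy
      have : (X n).Adj x y := by
        by_contra h
        exact hy (if_neg h)
      rw [Nat.cast_one, SimpleGraph.edist_le_one_iff_adj_or_eq]
      exact Or.inl this
  have h2 : ∀ x y, (if (X n).Adj x y then g x y else 0) =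
      (if x = u then if x = w then if (X n).Adj x y then 1 else 0 else 0 else 0) -
      (if x = u then if w = y then if (X n).Adj x y then 1 else 0 else 0 else 0) -
      (if u = y then if x = w then if (X n).Adj x y then 1 else 0 else 0 else 0) +
      (if u = y then if w = y then if (X n).Adj x y then 1 else 0 else 0 else 0) := by
    intro x y
    simp only [g]
    split_ifs <;> simp
  have hdeg : ∀ x, ((X n).degree x : ℂ) = ∑ y, if (X n).Adj x y then 1 else 0 := by
    intro x
    rw [Finset.sum_boole, SimpleGraph.degree, SimpleGraph.neighborFinset_eq_filter]
  calc ∑ x, ∑ k ∈ Finset.range N, g x (e k n x)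
      = ∑ x, ∑ y, if (X n).Adj x y then g x y else 0 := Finset.sum_congr rfl fun x _ => h1 x
    _ = 2 * (roeLaplacian X).entries n u w := by
      simp only [h2, Finset.sum_add_distrib, Finset.sum_sub_distrib, Finset.sum_ite_irrel,
        Finset.sum_const_zero, Finset.sum_ite_eq, Finset.sum_ite_eq', Finset.mem_univ, if_true]
      have h3 : ∑ x, (if (X n).Adj x u then 1 else 0 : ℂ) = (X n).degree u := by
        rw [hdeg]
        exact Finset.sum_congr rfl fun x _ => by rw [(X n).adj_comm]
      rw [h3, ← hdeg, roeLaplacian_entries, (X n).adj_comm w u]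
      by_cases huw : u = w
      · subst huw
        simp
        ring
      · rw [if_neg huw, if_neg (Ne.symm huw)]
        ring

/-! ### Invariant vectors -/

section Invariant

variable {H : Type*} [NormedAddCommGroup H] [InnerProductSpace ℂ H] [CompleteSpace H]
  (π : AlgebraicRoe X →⋆ₐ[ℂ] (H →L[ℂ] H)) {w : H}

/-- The index `k` may depend on the vertex, so the vertices are sorted by it. The diagonal
projections `P k` sum to 1, and `b'` is the sum of `P k` times the `k`-th composition, which fixes
`w`. -/
theorem map_roeMap_comp_of_map_roeMap (b b' : ∀ n, V n → V n) (hb : BoundedDisplacement X b)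
    (hb' : BoundedDisplacement X b') (N : ℕ) (e : ℕ → ∀ n, V n → V n)
    (he : ∀ k, BoundedDisplacement X (e k)) (hN : ∀ n x, ∃ k < N, e k n (b n x) = b' n x)
    (hw : ∀ k < N, π (roeMap X (e k) (he k)) w = w) (hbw : π (roeMap X b hb) w = w) :
    π (roeMap X b' hb') w = w := by
  choose idx hidx hidx' using hN
  let P : ℕ → AlgebraicRoe X := fun k => roeDiag X (fun n x => if idx n x = k then 1 else 0)
    ⟨1, fun n x => by split_ifs <;> simp⟩
  have h1 : ∑ k ∈ Finset.range N, P k = 1 := by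
    refine AlgebraicRoe.ext fun n x y => ?_
    simp only [entries_sum, P, roeDiag_entries, entries_one]
    by_cases hxy : x = y
    · simp [hxy, hidx]
    · simp [hxy]
  have h2 : ∑ k ∈ Finset.range N, P k * (roeMap X b hb * roeMap X (e k) (he k)) =
      roeMap X b' hb' := by
    refine AlgebraicRoe.ext fun n x y => ?_
    simp only [entries_sum, P, roeDiag_mul_entries, roeMap_mul_entries]
    simp only [roeMap_entries, ite_mul, one_mul, zero_mul]
    rw [Finset.sum_ite_eq, if_pos (Finset.mem_range.2 (hidx n x)), hidx']
  rw [← h2, map_sum, sum_apply]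
  have h3 : ∀ k ∈ Finset.range N,
      π (P k * (roeMap X b hb * roeMap X (e k) (he k))) w = π (P k) w := by
    intro k hk
    rw [map_mul, map_mul, mul_apply_eq_comp, mul_apply_eq_comp, hw k (Finset.mem_range.1 hk), hbw]
  rw [Finset.sum_congr rfl h3, ← sum_apply, ← map_sum, h1,
    map_one, one_apply_eq_self]

/-- Vectors in the kernel of the Laplacian are invariant under maps of bounded displacement. -/
theorem map_roeMap_of_map_roeLaplacian (hw : π (roeLaplacian X) w = 0) (b : ∀ n, V n → V n)
    (hb : BoundedDisplacement X b) : π (roeMap X b hb) w = w := by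
  obtain ⟨N, e, v, he, hv, hN, hsum⟩ := exists_ball_enumeration X 1
  have hL := sum_star_mul_eq_roeLaplacian N e v he hv hsum
  have he' : ∀ k, BoundedDisplacement X (e k) := fun k => ⟨1, he k⟩
  have hfix : ∀ k < N, π (roeMap X (e k) (he' k)) w = w := by
    -- The sum equals twice `⟨w, Δw⟩`, so each difference kills `w`. Larger displacements follow by
    -- induction, splitting off the last edge of a path.
    have h1 : ∑ k ∈ Finset.range N, ‖π (1 - roeMap X (e k) (he' k)) w‖ ^ 2 = 0 := by
      simp only [norm_sq_eq_re_inner_star_mul]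
      rw [← Complex.re_sum, ← inner_sum, ← sum_apply, ← map_sum, hL, map_smul, smul_apply, hw]
      simp
    intro k hk
    have h2 := (Finset.sum_eq_zero_iff_of_nonneg fun k _ => sq_nonneg _).1 h1 k
      (Finset.mem_range.2 hk)
    have h3 : π (1 - roeMap X (e k) (he' k)) w = 0 := by simpa using h2
    rw [map_sub, map_one, sub_apply, one_apply_eq_self, sub_eq_zero] at h3
    exact h3.symm
  obtain ⟨R, hR⟩ := hb
  induction R generalizing b with
  | zero =>
    have h1 : roeMap X b ⟨0, hR⟩ = 1 := by
      refine AlgebraicRoe.ext fun n x y => ?_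
      have h2 : x = b n x := by simpa using hR n x
      rw [roeMap_entries, entries_one, ← h2]
      simp [eq_comm]
    rw [h1, map_one, one_apply_eq_self]
  | succ R ih =>
    have hstep : ∀ n x, ∃ y, (X n).edist x y ≤ R ∧ (X n).edist y (b n x) ≤ (1 : ℕ) := by
      intro n x
      have hRx := hR n x
      generalize b n x = y at hRx
      have htop : (X n).edist x y ≠ ⊤ := ne_top_of_le_ne_top (ENat.natCast_ne_top _) hRx
      obtain ⟨p, hp⟩ := SimpleGraph.exists_walk_of_edist_ne_top htop
      have hlen : p.length ≤ R + 1 := by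
        rw [← hp] at hRx
        exact_mod_cast hRx
      rw [← SimpleGraph.Walk.length_reverse] at hlen
      generalize p.reverse = q at hlen
      cases q with
      | nil => exact ⟨x, by simp, by simp⟩
      | cons h q =>
        rename_i y
        refine ⟨y, ?_, ?_⟩
        · rw [SimpleGraph.edist_comm]
          refine (SimpleGraph.edist_le q).trans ?_
          rw [SimpleGraph.Walk.length_cons] at hlen
          exact_mod_cast Nat.le_of_succ_le_succ hlen
        · rw [Nat.cast_one, SimpleGraph.edist_le_one_iff_adj_or_eq]
          exact Or.inl h.symm
    choose c hc hcb using hstep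
    exact map_roeMap_comp_of_map_roeMap π c b ⟨R, hc⟩ ⟨R + 1, hR⟩ N e he'
      (fun n x => hN n (c n x) (b n x) (hcb n x)) hfix (ih c hc)

/-- Elements of row sums one fix the kernel of the Laplacian. -/
theorem map_eq_self_of_map_roeLaplacian (hw : π (roeLaplacian X) w = 0) (T : AlgebraicRoe X)
    (hT : ∀ n x, ∑ y, T.entries n x y = 1) : π T w = w := by
  obtain ⟨R, hR⟩ := finitePropagation_entries T
  obtain ⟨M, hM⟩ := norm_entries_le T
  obtain ⟨N, e, v, he, hv, hN, hsum⟩ := exists_ball_enumeration X R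
  -- `T` is the sum of `a k` times the map `e k`, and the `a k` add up to the diagonal of row sums,
  -- which is 1.
  let a : ℕ → AlgebraicRoe X := fun k => roeDiag X (fun n x => v k n x * T.entries n x (e k n x))
    ⟨M, fun n x => by
      rcases hv k n x with h | ⟨h, -⟩
      · rw [h, one_mul]
        exact hM n x _
      · rw [h, zero_mul, norm_zero]
        exact (norm_nonneg _).trans (hM n x x)⟩
  have h1 : ∑ k ∈ Finset.range N, a k = 1 := by
    refine AlgebraicRoe.ext fun n x y => ?_
    simp only [entries_sum, a, roeDiag_entries, entries_one]
    by_cases hxy : x = y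
    · simp only [hxy, if_true]
      rw [hsum n y (fun z => T.entries n y z) (hR n y), hT]
    · simp [hxy]
  have h2 : ∑ k ∈ Finset.range N, a k * roeMap X (e k) ⟨R, he k⟩ = T := by
    refine AlgebraicRoe.ext fun n x y => ?_
    simp only [entries_sum, a, roeDiag_mul_entries, roeMap_entries]
    have h3 := hsum n x (fun z => if y = z then T.entries n x z else 0) fun z hz => by
      by_cases hyz : y = z
      · rw [if_pos hyz] at hz
        exact hR n x z hz
      · exact absurd (if_neg hyz) hz
    rw [Finset.sum_ite_eq, if_pos (Finset.mem_univ _)] at h3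
    rw [← h3]
    refine Finset.sum_congr rfl fun k _ => ?_
    by_cases hy : y = e k n x
    · simp only [if_pos hy, mul_one]
    · simp only [if_neg hy, mul_zero]
  rw [← h2, map_sum, sum_apply]
  have h3 : ∀ k, π (a k * roeMap X (e k) ⟨R, he k⟩) w = π (a k) w := by
    intro k
    rw [map_mul, mul_apply_eq_comp, map_roeMap_of_map_roeLaplacian π hw]
  rw [Finset.sum_congr rfl fun k _ => h3 k, ← sum_apply, ← map_sum, h1, map_one, one_apply_eq_self]

end Invariant

end RoeElements

/-! ### Averaging over cells -/

namespace SimpleGraph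

variable {W : Type*} {G : SimpleGraph W}

theorem exists_dist_eq_of_walk {c u y : W} (hG : G.Connected) (p : G.Walk u y) {i : ℕ}
    (hu : G.dist c u ≤ i) (hy : i ≤ G.dist c y) : ∃ w, G.dist c w = i := by
  induction p with
  | nil => exact ⟨_, le_antisymm hu hy⟩
  | cons h q ih =>
    rename_i u u' y
    by_cases hi : G.dist c u = i
    · exact ⟨u, hi⟩
    · have h1 : G.dist c u' ≤ G.dist c u + G.dist u u' := hG.dist_triangle
      rw [dist_eq_one_iff_adj.2 h] at h1
      exact ih (by omega) hy

/-- A walk from `c` to a point outside the ball meets every sphere of radius `0, …, ρ`. -/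
theorem min_le_ncard_ball [Fintype W] (hG : G.Connected) (c : W) (ρ : ℕ) :
    min (ρ + 1) (Fintype.card W) ≤ {y | G.dist c y ≤ ρ}.ncard := by
  classical
  by_cases h : ∀ y, G.dist c y ≤ ρ
  · have : {y | G.dist c y ≤ ρ} = Set.univ := Set.eq_univ_of_forall h
    rw [this, Set.ncard_univ, Nat.card_eq_fintype_card]
    exact min_le_right _ _
  · push Not at h
    obtain ⟨y, hy⟩ := h
    obtain ⟨p⟩ := hG.preconnected c y
    refine (min_le_left _ _).trans ?_
    have hsub : (Finset.range (ρ + 1) : Set ℕ) ⊆ G.dist c '' {y | G.dist c y ≤ ρ} := by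
      intro i hi
      have hi' : i < ρ + 1 := by simpa using hi
      obtain ⟨w, hw⟩ := exists_dist_eq_of_walk (c := c) hG p (i := i) (by simp) (by omega)
      exact ⟨w, by change G.dist c w ≤ ρ; omega, hw⟩
    have h1 := Set.ncard_le_ncard hsub (Set.toFinite _)
    rw [Set.ncard_coe_finset, Finset.card_range] at h1
    exact h1.trans (Set.ncard_image_le (Set.toFinite _))

/-- A partition of a connected graph into large cells of small diameter. -/
theorem exists_cells [Fintype W] [DecidableEq W] (hG : G.Connected) (ρ : ℕ) :
    ∃ cell : W → W, (∀ x, G.dist x (cell x) ≤ 2 * ρ) ∧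
      ∀ x, min (ρ + 1) (Fintype.card W) ≤ (Finset.univ.filter fun y => cell y = cell x).card := by
  classical
  -- The cells are the Voronoi cells of a maximal set of centres more than `2ρ` apart. Maximality
  -- bounds their radius by `2ρ`; separation puts the `ρ`-ball of each centre inside its cell.
  obtain ⟨S, hS⟩ := (Set.toFinite {S : Finset W | ∀ c ∈ S, ∀ c' ∈ S, c ≠ c' →
    2 * ρ < G.dist c c'}).exists_maximal ⟨∅, by simp⟩
  have hSsep := hS.prop
  have hcover : ∀ x, ∃ c ∈ S, G.dist x c ≤ 2 * ρ := by
    intro x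
    by_contra! hx
    have hins : ∀ c ∈ insert x S, ∀ c' ∈ insert x S, c ≠ c' → 2 * ρ < G.dist c c' := by
      intro c hc c' hc' hne
      rcases Finset.mem_insert.1 hc with h1 | h1 <;> rcases Finset.mem_insert.1 hc' with h2 | h2
      · exact absurd (h1.trans h2.symm) hne
      · exact h1 ▸ hx c' h2
      · rw [G.dist_comm]
        exact h2 ▸ hx c h1
      · exact hSsep c h1 c' h2 hne
    have hxS : x ∈ S := hS.le_of_ge (y := insert x S) hins (Finset.subset_insert x S)
      (Finset.mem_insert_self x S)
    have := hx x hxS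
    simp at this
  have hmin : ∀ x, ∃ c ∈ S, ∀ c' ∈ S, G.dist x c ≤ G.dist x c' := fun x => by
    obtain ⟨c, hc, -⟩ := hcover x
    exact Finset.exists_min_image S (G.dist x) ⟨c, hc⟩
  choose cell hcell hcell' using hmin
  refine ⟨cell, fun x => ?_, fun x => ?_⟩
  · obtain ⟨c, hc, hxc⟩ := hcover x
    exact (hcell' x c hc).trans hxc
  · refine (min_le_ncard_ball hG (cell x) ρ).trans ?_
    rw [← Set.ncard_coe_finset]
    refine Set.ncard_le_ncard (fun y hy => ?_) (Set.toFinite _)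
    have hy' : G.dist (cell x) y ≤ ρ := hy
    simp only [Finset.coe_filter, Finset.mem_univ, true_and]
    change cell y = cell x
    by_contra hne
    have h1 := hSsep _ (hcell y) _ (hcell x) hne
    have h2 := hcell' y _ (hcell x)
    have h3 : G.dist (cell y) (cell x) ≤ G.dist (cell y) y + G.dist y (cell x) := hG.dist_triangle
    rw [G.dist_comm (u := cell y) (v := y)] at h3
    rw [G.dist_comm (u := cell x) (v := y)] at hy'
    omega

end SimpleGraph

section Averaging

variable {V : ℕ → Type u} [∀ n, Fintype (V n)] [∀ n, DecidableEq (V n)]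

/-- A projection in `ℂ_cs[X]` that averages over large cells. -/
theorem exists_averaging_projection (X : ∀ n, SimpleGraph (V n)) [UniformlyBoundedDegree X]
    (hconn : ∀ n, (X n).Connected) (ρ : ℕ) :
    ∃ A : AlgebraicRoe X, star A = A ∧ A * A = A ∧ (∀ n x, ∑ y, A.entries n x y = 1) ∧
      ∃ a : ∀ n, V n → V n → ℝ, (∀ n x y, A.entries n x y = (a n x y : ℂ)) ∧
        (∀ n x y, 0 ≤ a n x y) ∧
        ∀ n x y, ρ + 1 ≤ Fintype.card (V n) → a n x y ≤ 1 / ((ρ : ℝ) + 1) := by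
  choose cell hcell hcard using fun n => SimpleGraph.exists_cells (hconn n) ρ
  let m : ∀ n, V n → ℕ := fun n x => (Finset.univ.filter fun y => cell n y = cell n x).card
  have hm : ∀ n x, 0 < m n x := fun n x => Finset.card_pos.2 ⟨x, by simp⟩
  have hm' : ∀ n x y, cell n x = cell n y → m n x = m n y := fun n x y h => by simp only [m, h]
  -- Row `x` is the uniform distribution on the cell of `x`. Its propagation is at most `4ρ`,
  -- through the common centre.
  let a : ∀ n, V n → V n → ℝ := fun n x y => if cell n y = cell n x then 1 / (m n x : ℝ) else 0
  have ha0 : ∀ n x y, 0 ≤ a n x y := fun n x y => by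
    simp only [a]
    split_ifs <;> positivity
  have ha1 : ∀ n x, ∑ y, a n x y = 1 := fun n x => by
    have : (m n x : ℝ) ≠ 0 := by exact_mod_cast (hm n x).ne'
    simp only [a]
    rw [← Finset.sum_filter, Finset.sum_const, nsmul_eq_mul]
    change (m n x : ℝ) * (1 / (m n x : ℝ)) = 1
    field_simp
  have hasymm : ∀ n x y, a n x y = a n y x := fun n x y => by
    by_cases h : cell n y = cell n x
    · simp [a, h, hm' n y x h]
    · simp [a, h, Ne.symm h]
  have hmem : (fun n => Matrix.of fun x y => (a n x y : ℂ)) ∈ roeSubalgebra X := by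
    refine mem_roeSubalgebra_of_entries X _ ⟨4 * ρ, fun n x y h => ?_⟩ 1 fun n x y => ?_
    · have hxy : cell n y = cell n x := by
        by_contra hxy
        exact h (by simp [a, hxy])
      have h1 : (X n).dist x y ≤ (X n).dist x (cell n x) + (X n).dist (cell n x) y :=
        (hconn n).dist_triangle
      have h2 := hcell n x
      have h3 := hcell n y
      rw [(X n).dist_comm, hxy] at h3
      rw [← ((hconn n).preconnected x y).coe_dist_eq_edist]
      have h4 : (X n).dist x y ≤ 4 * ρ := by omega
      exact_mod_cast h4
    · rw [Matrix.of_apply, Complex.norm_real, Real.norm_of_nonneg (ha0 n x y), ← ha1 n x]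
      exact Finset.single_le_sum (fun z _ => ha0 n x z) (Finset.mem_univ y)
  let A : AlgebraicRoe X := ⟨_, hmem⟩
  have hA : ∀ n x y, A.entries n x y = (a n x y : ℂ) := fun n x y => rfl
  refine ⟨A, ?_, ?_, fun n x => ?_, a, hA, ha0, fun n x y hn => ?_⟩
  · refine AlgebraicRoe.ext fun n x y => ?_
    rw [entries_star, hA, hA, Complex.star_def, Complex.conj_ofReal, hasymm]
  · refine AlgebraicRoe.ext fun n x y => ?_
    simp only [entries_mul, hA, ← Complex.ofReal_mul, ← Complex.ofReal_sum]
    congr 1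
    have h1 : ∀ z, a n x z * a n z y = a n x z * a n x y := by
      intro z
      by_cases h : cell n z = cell n x
      · simp only [a, h, hm' n z x h]
      · simp [a, h]
    rw [Finset.sum_congr rfl fun z _ => h1 z, ← Finset.sum_mul, ha1, one_mul]
  · simp only [hA, ← Complex.ofReal_sum, ha1, Complex.ofReal_one]
  · have h1 : ρ + 1 ≤ m n x := by
      have := hcard n x
      rwa [min_eq_left hn] at this
    have h2 : (ρ : ℝ) + 1 ≤ m n x := by exact_mod_cast h1
    simp only [a]
    split_ifs
    · exact one_div_le_one_div_of_le (by positivity) h2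
    · positivity

end Averaging

/-! ### Functionals given by kernels on the vertices -/

theorem Ultrafilter.exists_tendsto_of_bounded (U : Ultrafilter ℕ) {f : ℕ → ℂ} {C : ℝ}
    (hf : ∀ n, ‖f n‖ ≤ C) : ∃ z, Tendsto f U (𝓝 z) := by
  obtain ⟨z, -, hz⟩ := (isCompact_closedBall (0 : ℂ) C).ultrafilter_le_nhds (U.map f) (by
    rw [le_principal_iff]
    exact Filter.mem_map.2 (Filter.univ_mem' fun n => by simpa using hf n))
  exact ⟨z, hz⟩

section KernelFunctional

variable {V : ℕ → Type u} [∀ n, Fintype (V n)] [∀ n, DecidableEq (V n)]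
variable {X : ∀ n, SimpleGraph (V n)}

/-- The normalised pairing of a sequence of matrices with the kernel `t ^ d(x, y)`. -/
noncomputable def kernelMean (Y : ∀ n, SimpleGraph (V n)) (t : ℝ) (T : AlgebraicRoe X) (n : ℕ) :
    ℂ :=
  (∑ x, ∑ y, T.entries n x y * ((t ^ (Y n).dist x y : ℝ) : ℂ)) / (Fintype.card (V n) : ℂ)

variable (Y : ∀ n, SimpleGraph (V n)) (t : ℝ)

theorem kernelMean_add (S T : AlgebraicRoe X) (n : ℕ) :
    kernelMean Y t (S + T) n = kernelMean Y t S n + kernelMean Y t T n := by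
  simp only [kernelMean, map_add, Pi.add_apply, Matrix.add_apply, add_mul, Finset.sum_add_distrib,
    add_div]

theorem kernelMean_smul (c : ℂ) (T : AlgebraicRoe X) (n : ℕ) :
    kernelMean Y t (c • T) n = c * kernelMean Y t T n := by
  simp only [kernelMean, entries_smul, mul_assoc, ← Finset.mul_sum, mul_div_assoc]

theorem kernelMean_star (T : AlgebraicRoe X) (n : ℕ) :
    kernelMean Y t (star T) n = star (kernelMean Y t T n) := by
  simp only [kernelMean, entries_star, Complex.star_def, map_div₀, map_sum, map_mul,
    Complex.conj_ofReal, Complex.conj_natCast]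
  rw [Finset.sum_comm]
  refine congrArg (· / _) (Finset.sum_congr rfl fun x _ => Finset.sum_congr rfl fun y _ => ?_)
  rw [(Y n).dist_comm]

variable {t}

theorem exists_row_sum_bound [UniformlyBoundedDegree X] (T : AlgebraicRoe X) :
    ∃ C : ℝ, 0 ≤ C ∧ ∀ n x, ∑ y, ‖T.entries n x y‖ ≤ C := by
  classical
  obtain ⟨R, hR⟩ := finitePropagation_entries T
  obtain ⟨M, hM⟩ := norm_entries_le T
  obtain ⟨N, hN⟩ := exists_ball_bound X R
  refine ⟨N * |M|, by positivity, fun n x => ?_⟩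
  have h1 : ∑ y, ‖T.entries n x y‖ =
      ∑ y ∈ {y | (X n).edist x y ≤ R}.toFinset, ‖T.entries n x y‖ := by
    refine (Finset.sum_subset (Finset.subset_univ _) fun y _ hy => ?_).symm
    by_contra h
    exact hy (by simpa using hR n x y (fun h0 => h (by rw [h0, norm_zero])))
  rw [h1]
  refine (Finset.sum_le_card_nsmul _ _ |M| fun y _ => (hM n x y).trans (le_abs_self M)).trans ?_
  rw [nsmul_eq_mul, ← Set.ncard_eq_toFinset_card']
  exact mul_le_mul_of_nonneg_right (by exact_mod_cast hN n x) (abs_nonneg M)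

theorem norm_pow_dist_le (ht : |t| ≤ 1) (k : ℕ) : ‖((t ^ k : ℝ) : ℂ)‖ ≤ 1 := by
  rw [Complex.norm_real, Real.norm_eq_abs, abs_pow]
  exact pow_le_one₀ (abs_nonneg t) ht

theorem exists_kernelMean_bound [UniformlyBoundedDegree X] (ht : |t| ≤ 1) (T : AlgebraicRoe X) :
    ∃ C : ℝ, ∀ n, ‖kernelMean Y t T n‖ ≤ C := by
  obtain ⟨C, hC0, hC⟩ := exists_row_sum_bound T
  refine ⟨C, fun n => ?_⟩
  rw [kernelMean, norm_div, Complex.norm_natCast]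
  refine div_le_of_le_mul₀ (Nat.cast_nonneg _) hC0 ?_
  refine (norm_sum_le _ _).trans ?_
  refine (Finset.sum_le_card_nsmul _ _ C fun x _ => ?_).trans ?_
  · refine (norm_sum_le _ _).trans (le_trans (Finset.sum_le_sum fun y _ => ?_) (hC n x))
    rw [norm_mul]
    exact mul_le_of_le_one_right (norm_nonneg _) (norm_pow_dist_le ht _)
  · rw [nsmul_eq_mul, Finset.card_univ, mul_comm]

/-- The vertices near an edge with a detour. -/
def nearDetours {W : Type*} (G : SimpleGraph W) (s : ℕ) : Set W :=
  {z | ∃ x y, G.dist x z ≤ 3 * s ∧ s(x, y) ∈ G.detourEdges (2 * (3 * s))}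

/-- Each detour edge spoils only the balls around its two end points. The radius and detour length
are those of `re_sum_pow_dist_nonneg`. -/
theorem ncard_nearDetours_le {W : Type*} [Fintype W] (G : SimpleGraph W) (s N : ℕ)
    (hN : ∀ x, {y | G.dist x y ≤ 3 * s}.ncard ≤ N) :
    (nearDetours G s).ncard ≤ (G.detourEdges (2 * (3 * s))).ncard * (2 * N) := by
  classical
  have hfin : (G.detourEdges (2 * (3 * s))).Finite := Set.toFinite _
  have hsub : nearDetours G s ⊆ ⋃ e ∈ hfin.toFinset,
      ({z | G.dist e.out.1 z ≤ 3 * s} ∪ {z | G.dist e.out.2 z ≤ 3 * s}) := by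
    rintro z ⟨x, y, hx, he⟩
    simp only [Set.mem_iUnion]
    refine ⟨s(x, y), hfin.mem_toFinset.2 he, ?_⟩
    have hout : s((s(x, y) : Sym2 W).out.1, (s(x, y) : Sym2 W).out.2) = s(x, y) := Quot.out_eq _
    rcases Sym2.eq_iff.1 hout with ⟨h1, -⟩ | ⟨-, h2⟩
    · left
      change G.dist _ z ≤ _
      rw [h1]
      exact hx
    · right
      change G.dist _ z ≤ _
      rw [h2]
      exact hx
  refine (Set.ncard_le_ncard hsub (Set.toFinite _)).trans
    ((Finset.set_ncard_biUnion_le _ _).trans ?_)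
  refine (Finset.sum_le_card_nsmul _ _ (2 * N) fun e _ => ?_).trans ?_
  · refine (Set.ncard_union_le _ _).trans ?_
    have h1 := hN e.out.1
    have h2 := hN e.out.2
    omega
  · rw [smul_eq_mul, Set.ncard_eq_toFinset_card _ hfin]

theorem kernelMean_star_mul_self (S : AlgebraicRoe X) (n : ℕ) :
    kernelMean Y t (star S * S) n = (∑ z, ∑ x, ∑ y, star (S.entries n z x) * S.entries n z y *
      ((t ^ (Y n).dist x y : ℝ) : ℂ)) / (Fintype.card (V n) : ℂ) := by
  simp only [kernelMean, entries_mul, entries_star, Finset.sum_mul]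
  refine congrArg (· / _) ?_
  calc _ = ∑ x, ∑ z, ∑ y, star (S.entries n z x) * S.entries n z y *
      ((t ^ (Y n).dist x y : ℝ) : ℂ) := Finset.sum_congr rfl fun x _ => Finset.sum_comm
    _ = _ := Finset.sum_comm

variable {Y}

/-- The functional is almost positive when most balls are trees. -/
theorem exists_neg_le_re_kernelMean [UniformlyBoundedDegree X] (hXY : SameCoarseStructure X Y)
    (ht : |t| ≤ 1) (S : AlgebraicRoe X) :
    ∃ (C : ℝ) (k : ℕ), ∀ n, -(C * (((Y n).detourEdges k).ncard / (Fintype.card (V n) : ℝ))) ≤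
      (kernelMean Y t (star S * S) n).re := by
  classical
  obtain ⟨R, hR⟩ := finitePropagation_entries S
  obtain ⟨L, hL⟩ := hXY.exists_nat
  obtain ⟨C, hC0, hC⟩ := exists_row_sum_bound S
  obtain ⟨N, hN⟩ := hXY.exists_ball_bound (3 * (L * R))
  let s := L * R
  have hs : ∀ n z x, S.entries n z x ≠ 0 → (Y n).dist x z ≤ s := by
    intro n z x h
    have h1 := hR n z x h
    rw [← ((hXY.1 n).preconnected z x).coe_dist_eq_edist] at h1
    have h2 : (X n).dist z x ≤ R := by exact_mod_cast h1
    rw [(Y n).dist_comm]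
    exact (hL n z x).2.trans (Nat.mul_le_mul_left L h2)
  refine ⟨2 * N * C ^ 2, 2 * (3 * s), fun n => ?_⟩
  rw [kernelMean_star_mul_self]
  -- Row `z` of `S` lives in the `s`-ball of `z` in `Y`, so `Q z` has nonnegative real part away
  -- from detours. The few remaining rows are bounded crudely by `C ^ 2`.
  let Q : V n → ℂ := fun z => ∑ x, ∑ y, star (S.entries n z x) * S.entries n z y *
      ((t ^ (Y n).dist x y : ℝ) : ℂ)
  have hQ1 : ∀ z, z ∉ nearDetours (Y n) s → 0 ≤ (Q z).re := by
    intro z hz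
    refine SimpleGraph.re_sum_pow_dist_nonneg (hXY.2.1 n) (z := z) (s := s) (fun x y hx he => ?_)
      ?_ (fun x => S.entries n z x) (hs n z)
    · exact hz ⟨x, y, hx, he⟩
    · exact (sq_le_one_iff_abs_le_one t).2 ht
  have hQ2 : ∀ z, -C ^ 2 ≤ (Q z).re := by
    intro z
    have h1 : ‖Q z‖ ≤ C ^ 2 := by
      calc ‖Q z‖ ≤ ∑ x, ∑ y, ‖S.entries n z x‖ * ‖S.entries n z y‖ := by
            refine (norm_sum_le _ _).trans (Finset.sum_le_sum fun x _ => ?_)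
            refine (norm_sum_le _ _).trans (Finset.sum_le_sum fun y _ => ?_)
            rw [norm_mul, norm_mul, norm_star]
            exact mul_le_of_le_one_right (by positivity) (norm_pow_dist_le ht _)
        _ = (∑ x, ‖S.entries n z x‖) * ∑ y, ‖S.entries n z y‖ := by rw [Finset.sum_mul_sum]
        _ ≤ C * C := mul_le_mul (hC n z) (hC n z)
            (Finset.sum_nonneg fun _ _ => norm_nonneg _) hC0
        _ = C ^ 2 := by ring
    have h2 := (Complex.abs_re_le_norm (Q z)).trans h1
    linarith [neg_abs_le (Q z).re]
  have hsum : -(C ^ 2 * (nearDetours (Y n) s).ncard) ≤ ∑ z, (Q z).re := by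
    have h1 : ∑ z, (if z ∈ nearDetours (Y n) s then -C ^ 2 else 0) ≤ ∑ z, (Q z).re := by
      refine Finset.sum_le_sum fun z _ => ?_
      split_ifs with hz
      · exact hQ2 z
      · exact hQ1 z hz
    refine le_trans (le_of_eq ?_) h1
    rw [← Finset.sum_filter, Finset.sum_const, nsmul_eq_mul, Set.ncard_eq_toFinset_card']
    have : (nearDetours (Y n) s).toFinset = Finset.univ.filter (· ∈ nearDetours (Y n) s) := by
      ext
      simp
    rw [this]
    ring
  have hnear : ((nearDetours (Y n) s).ncard : ℝ) ≤
      (((Y n).detourEdges (2 * (3 * s))).ncard : ℝ) * (2 * N) := by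
    exact_mod_cast ncard_nearDetours_le (Y n) s N (hN n)
  change _ ≤ ((∑ z, Q z) / (Fintype.card (V n) : ℂ)).re
  rw [← Complex.ofReal_natCast, Complex.div_ofReal_re, Complex.re_sum, ← mul_div_assoc, ← neg_div]
  refine div_le_div_of_nonneg_right (le_trans ?_ hsum) (Nat.cast_nonneg _)
  have := mul_le_mul_of_nonneg_left hnear (sq_nonneg C)
  linarith

end KernelFunctional

/-! ### The limit functional -/

section LimitFunctional

variable {V : ℕ → Type u} [∀ n, Fintype (V n)] [∀ n, DecidableEq (V n)]
variable {X : ∀ n, SimpleGraph (V n)} [UniformlyBoundedDegree X]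

/-- The complement `b k` certifies `a⋆ a ≤ c` inside the algebra itself, so any positive functional
sees this bound without a norm. -/
theorem exists_sum_of_bounded_columns (T : AlgebraicRoe X) :
    ∃ (N : ℕ) (c : ℝ) (a b : ℕ → AlgebraicRoe X), T = ∑ k ∈ Finset.range N, a k ∧
      ∀ k, star (a k) * a k + star (b k) * b k = algebraMap ℂ (AlgebraicRoe X) (c : ℂ) := by
  obtain ⟨M, hM⟩ := norm_entries_le T
  obtain ⟨N, c, A, B, hsum, hAB⟩ :=
    exists_row_decomposition X T.entries (finitePropagation_entries T) M hM
  let a : ℕ → AlgebraicRoe X := fun k =>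
    ⟨A k, isBoundedSeq_of_star_mul_add _ _ c (hAB k).2.2, (hAB k).1⟩
  let b : ℕ → AlgebraicRoe X := fun k =>
    ⟨B k, isBoundedSeq_of_star_mul_add _ _ c ((add_comm _ _).trans (hAB k).2.2), (hAB k).2.1⟩
  refine ⟨N, c, a, b, AlgebraicRoe.ext fun n x y => ?_, fun k => Subtype.ext (hAB k).2.2⟩
  rw [hsum, entries_sum, Finset.sum_apply, Matrix.sum_apply]
  rfl

/-- A positive functional on `ℂ_cs[X]` has bounded left multiplications. -/
theorem exists_bound_of_positive (f : AlgebraicRoe X →ₗ[ℂ] ℂ)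
    (hf : ∀ a, 0 ≤ (f (star a * a)).re) (T : AlgebraicRoe X) :
    ∃ C : ℝ, 0 ≤ C ∧ ∀ b, (f (star (T * b) * (T * b))).re ≤ C ^ 2 * (f (star b * b)).re := by
  have hlin : ∃ C : ℝ, 0 ≤ C ∧
      ∀ b, (f (star (T * b) * (T * b))).re ≤ C * (f (star b * b)).re := by
    obtain ⟨N, c, a, b, rfl, hab⟩ := exists_sum_of_bounded_columns T
    induction N with
    | zero => exact ⟨0, le_rfl, fun b => by simp⟩
    | succ N ih =>
      obtain ⟨C, hC0, hC⟩ := ih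
      refine ⟨2 * C + 2 * |c|, by positivity, fun v => ?_⟩
      rw [Finset.sum_range_succ]
      set S := ∑ k ∈ Finset.range N, a k
      -- Parallelogram identity: dropping the positive difference term bounds the square of a sum by
      -- twice the sum of the squares.
      have h1 : star (S * v + a N * v) * (S * v + a N * v) +
          star (S * v - a N * v) * (S * v - a N * v) =
          (2 : ℂ) • (star (S * v) * (S * v)) + (2 : ℂ) • (star (a N * v) * (a N * v)) := by
        rw [two_smul, two_smul, star_add, star_sub]
        noncomm_ring
      have h2 : star (a N * v) * (a N * v) + star (b N * v) * (b N * v) =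
          (c : ℂ) • (star v * v) := by
        have : star (a N * v) * (a N * v) + star (b N * v) * (b N * v) =
            star v * (star (a N) * a N + star (b N) * b N) * v := by
          rw [star_mul, star_mul]
          noncomm_ring
        rw [this, hab, Algebra.algebraMap_eq_smul_one]
        simp
      have h3 := congrArg (fun z => (f z).re) h1
      have h4 := congrArg (fun z => (f z).re) h2
      simp only [map_add, map_smul, Complex.add_re, smul_eq_mul, Complex.re_ofReal_mul] at h3 h4
      have h5 : ∀ z : ℂ, (2 * z).re = 2 * z.re := fun z => by simp
      rw [h5, h5] at h3
      have h6 := hf (S * v - a N * v)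
      have h7 := hf (b N * v)
      have h8 := hC v
      have h9 := mul_le_mul_of_nonneg_right (le_abs_self c) (hf v)
      rw [add_mul]
      linarith
  obtain ⟨C, hC0, hC⟩ := hlin
  exact ⟨√C, Real.sqrt_nonneg C, by rwa [Real.sq_sqrt hC0]⟩

/-- The limit of the functionals `kernelMean` along an ultrafilter, when most balls are trees. -/
theorem exists_limit_functional {Y : ∀ n, SimpleGraph (V n)} (hXY : SameCoarseStructure X Y)
    {t : ℝ} (ht : |t| ≤ 1) (U : Ultrafilter ℕ)
    (hU : ∀ k, Tendsto (fun n => (((Y n).detourEdges k).ncard : ℝ) / (Fintype.card (V n) : ℝ)) U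
      (𝓝 0)) :
    ∃ f : BoundedPositiveFunctional (AlgebraicRoe X),
      ∀ T, Tendsto (kernelMean Y t T) U (𝓝 (f.toLin T)) := by
  have hlim : ∀ T : AlgebraicRoe X, ∃ z, Tendsto (kernelMean Y t T) U (𝓝 z) := fun T => by
    obtain ⟨C, hC⟩ := exists_kernelMean_bound Y ht T
    exact U.exists_tendsto_of_bounded hC
  choose f hf using hlim
  let F : AlgebraicRoe X →ₗ[ℂ] ℂ :=
    { toFun := f
      map_add' := fun S T => tendsto_nhds_unique (hf (S + T)) (
        ((hf S).add (hf T)).congr fun n => (kernelMean_add Y t S T n).symm)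
      map_smul' := fun c T => tendsto_nhds_unique (hf (c • T)) (
        ((hf T).const_mul c).congr fun n => (kernelMean_smul Y t c T n).symm) }
  have hpos : ∀ S, 0 ≤ (F (star S * S)).re := by
    intro S
    obtain ⟨C, k, hC⟩ := exists_neg_le_re_kernelMean hXY ht S
    have h1 := (Complex.continuous_re.tendsto _).comp (hf (star S * S))
    have h2 := ((hU k).const_mul C).neg
    rw [mul_zero, neg_zero] at h2
    exact le_of_tendsto_of_tendsto' h2 h1 hC
  refine ⟨⟨F, fun T => ?_, hpos, exists_bound_of_positive F hpos⟩, hf⟩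
  exact tendsto_nhds_unique (hf (star T))
    ((hf T).star.congr fun n => (kernelMean_star Y t T n).symm)

end LimitFunctional

/-! ### Estimates of the functional -/

section Estimates

variable {V : ℕ → Type u} [∀ n, Fintype (V n)] [∀ n, DecidableEq (V n)]
variable {X Y : ∀ n, SimpleGraph (V n)} {t : ℝ}

theorem kernelMean_one (hconn : ∀ n, (X n).Connected) (n : ℕ) :
    kernelMean Y t (1 : AlgebraicRoe X) n = 1 := by
  have := (hconn n).nonempty
  have h : (Fintype.card (V n) : ℂ) ≠ 0 := by exact_mod_cast Fintype.card_ne_zero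
  simp [kernelMean, entries_one, h]

theorem kernelMean_re_eq {T : AlgebraicRoe X} {n : ℕ} {a : V n → V n → ℝ}
    (ha : ∀ x y, T.entries n x y = (a x y : ℂ)) :
    (kernelMean Y t T n).re =
      (∑ x, ∑ y, a x y * t ^ (Y n).dist x y) / (Fintype.card (V n) : ℝ) := by
  simp only [kernelMean, ha, ← Complex.ofReal_mul, ← Complex.ofReal_sum]
  rw [← Complex.ofReal_natCast, Complex.div_ofReal_re, Complex.ofReal_re]

theorem kernelMean_re_le {T : AlgebraicRoe X} {n : ℕ} {a : V n → V n → ℝ} {B : ℝ} (hB : 0 ≤ B)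
    (ha : ∀ x y, T.entries n x y = (a x y : ℂ))
    (h : ∀ x, ∑ y, a x y * t ^ (Y n).dist x y ≤ B) : (kernelMean Y t T n).re ≤ B := by
  rw [kernelMean_re_eq ha]
  refine div_le_of_le_mul₀ (Nat.cast_nonneg _) hB ?_
  refine (Finset.sum_le_card_nsmul _ _ B fun x _ => h x).trans ?_
  rw [nsmul_eq_mul, Finset.card_univ, mul_comm]

/-- Within distance `D` a row has at most `N` entries, each at most `δ`; the rest of its mass, at
most 1, is weighted by at most `t ^ D`. -/
theorem kernelMean_re_le_of_spread (ht0 : 0 ≤ t) (ht1 : t ≤ 1) {D N : ℕ} {δ : ℝ} (hδ : 0 ≤ δ)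
    {T : AlgebraicRoe X} {n : ℕ} {a : V n → V n → ℝ}
    (hN : ∀ x : V n, {y | (Y n).dist x y ≤ D}.ncard ≤ N)
    (ha : ∀ x y, T.entries n x y = (a x y : ℂ)) (ha0 : ∀ x y, 0 ≤ a x y)
    (ha1 : ∀ x, ∑ y, a x y = 1) (haδ : ∀ x y, a x y ≤ δ) :
    (kernelMean Y t T n).re ≤ N * δ + t ^ D := by
  classical
  refine kernelMean_re_le (by positivity) ha fun x => ?_
  have h1 : ∀ y, a x y * t ^ (Y n).dist x y ≤
      (if (Y n).dist x y ≤ D then δ else 0) + a x y * t ^ D := by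
    intro y
    split_ifs with h
    · have h2 : a x y * t ^ (Y n).dist x y ≤ δ :=
        (mul_le_of_le_one_right (ha0 x y) (pow_le_one₀ ht0 ht1)).trans (haδ x y)
      have h3 := mul_nonneg (ha0 x y) (pow_nonneg ht0 D)
      linarith
    · rw [zero_add]
      exact mul_le_mul_of_nonneg_left (pow_le_pow_of_le_one ht0 ht1 (by omega)) (ha0 x y)
  refine (Finset.sum_le_sum fun y _ => h1 y).trans ?_
  rw [Finset.sum_add_distrib, ← Finset.sum_mul, ha1, one_mul, ← Finset.sum_filter,
    Finset.sum_const, nsmul_eq_mul]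
  refine add_le_add_left (mul_le_mul_of_nonneg_right ?_ hδ) _
  have := hN x
  rw [Set.ncard_eq_toFinset_card'] at this
  refine le_trans ?_ (Nat.cast_le.2 this)
  rw [Nat.cast_le]
  exact Finset.card_le_card fun y hy => by simpa using hy

variable [UniformlyBoundedDegree X]

theorem kernelMean_roeLaplacian_re_le {d L : ℕ} (hd : DegreeAtMost X d) (ht0 : 0 ≤ t) (ht1 : t ≤ 1)
    (hL : ∀ n (x y : V n), (X n).Adj x y → (Y n).dist x y ≤ L) (n : ℕ) :
    (kernelMean Y t (roeLaplacian X) n).re ≤ d * (1 - t ^ L) := by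
  classical
  have hB : 0 ≤ 1 - t ^ L := sub_nonneg.2 (pow_le_one₀ ht0 ht1)
  refine kernelMean_re_le (a := fun x y => (if x = y then ((X n).degree x : ℝ) else 0) -
    if (X n).Adj x y then 1 else 0) (by positivity) (fun x y => ?_) fun x => ?_
  · rw [roeLaplacian_entries, Complex.ofReal_sub]
    congr 1 <;> split_ifs <;> simp
  · simp only [sub_mul, ite_mul, zero_mul, one_mul, Finset.sum_sub_distrib, Finset.sum_ite_eq,
      Finset.mem_univ, if_true, SimpleGraph.dist_self, pow_zero, mul_one]
    rw [← Finset.sum_filter]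
    have hdeg : (Finset.univ.filter fun y => (X n).Adj x y).card = (X n).degree x := by
      rw [SimpleGraph.degree, SimpleGraph.neighborFinset_eq_filter]
    have h1 := Finset.card_nsmul_le_sum (Finset.univ.filter fun y => (X n).Adj x y)
      (fun y => t ^ (Y n).dist x y) (t ^ L) fun y hy =>
        pow_le_pow_of_le_one ht0 ht1 (hL n x y (Finset.mem_filter.1 hy).2)
    rw [hdeg, nsmul_eq_mul] at h1
    have h2 : ((X n).degree x : ℝ) ≤ d := by
      have := hd n x
      rw [Set.ncard_eq_toFinset_card'] at this
      exact_mod_cast this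
    have h3 := mul_le_mul_of_nonneg_right h2 hB
    linarith

end Estimates

/-! ### Spectral gap and short detours -/

section Main

variable {V : ℕ → Type u} [∀ n, Fintype (V n)] [∀ n, DecidableEq (V n)]
variable {X : ∀ n, SimpleGraph (V n)}

theorem exists_pow_close_to_one (d L : ℕ) {η : ℝ} (hη : 0 < η) :
    ∃ t : ℝ, 0 ≤ t ∧ t < 1 ∧ d * (1 - t ^ L) ≤ η := by
  have h1 : Tendsto (fun t : ℝ => d * (1 - t ^ L)) (𝓝[<] 1) (𝓝 (d * (1 - 1 ^ L))) := by
    refine Tendsto.mono_left ?_ nhdsWithin_le_nhds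
    exact (Continuous.tendsto (by fun_prop) 1)
  rw [one_pow, sub_self, mul_zero] at h1
  have h2 := h1.eventually (eventually_le_nhds hη)
  have h3 : ∀ᶠ t : ℝ in 𝓝[<] 1, t ∈ Set.Ioo (0 : ℝ) 1 := Ioo_mem_nhdsLT zero_lt_one
  obtain ⟨t, ht, ht'⟩ := (h2.and h3).exists
  exact ⟨t, ht'.1.le, ht'.2, ht⟩

/-- For a self-adjoint idempotent, `‖Av‖² = ⟨v, Av⟩`, and Cauchy–Schwarz applies. -/
theorem norm_apply_le_of_projection [UniformlyBoundedDegree X] {H : Type*} [NormedAddCommGroup H]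
    [InnerProductSpace ℂ H] [CompleteSpace H] (π : AlgebraicRoe X →⋆ₐ[ℂ] (H →L[ℂ] H))
    {A : AlgebraicRoe X} (hstar : star A = A) (hA : A * A = A) (v : H) : ‖π A v‖ ≤ ‖v‖ := by
  have h1 := norm_sq_eq_re_inner_star_mul π A v
  rw [hstar, hA] at h1
  have h2 : (inner ℂ v (π A v)).re ≤ ‖v‖ * ‖π A v‖ :=
    (Complex.re_le_norm _).trans (norm_inner_le_norm _ _)
  by_contra! h
  nlinarith [norm_nonneg v]

/-- A sequence with a spectral gap in the maximal algebra has many edges with short detours, in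
every sequence of graphs inducing the same coarse structure. -/
theorem not_tendsto_detourEdges_of_spectral_gap [UniformlyBoundedDegree X]
    {Y : ∀ n, SimpleGraph (V n)} (hXY : SameCoarseStructure X Y) {γ : ℝ} (hγ : 0 < γ)
    (hspec : spectrum ℂ ((roeLaplacian X : AlgebraicRoe X) : MaxRoe X) ⊆
      {0} ∪ Complex.ofReal '' Set.Ici γ) (U : Ultrafilter ℕ)
    (hcard : Tendsto (fun n => Fintype.card (V n)) U atTop)
    (hU : ∀ k, Tendsto (fun n => (((Y n).detourEdges k).ncard : ℝ) / (Fintype.card (V n) : ℝ)) U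
      (𝓝 0)) : False := by
  obtain ⟨d, hd⟩ := UniformlyBoundedDegree.exists_bound (X := X)
  obtain ⟨L, hL⟩ := hXY.exists_nat
  -- The order of choices matters: `t` makes the Laplacian small relative to the gap, then `D` makes
  -- `t ^ D` small, and finally cells of size above `32 N` beat the balls of radius `D`.
  obtain ⟨t, ht0, ht1, ht⟩ := exists_pow_close_to_one d L (η := γ / 16) (by positivity)
  obtain ⟨f, hf⟩ := exists_limit_functional hXY (abs_le.2 ⟨by linarith, ht1.le⟩) U hU
  obtain ⟨D, hD⟩ := exists_pow_lt_of_lt_one (show (0 : ℝ) < 1 / 32 by norm_num) ht1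
  obtain ⟨N, hN⟩ := hXY.exists_ball_bound D
  obtain ⟨ρ, hρ⟩ := exists_nat_ge (32 * N : ℝ)
  obtain ⟨A, hAstar, hAA, hA1, a, haA, ha0, haρ⟩ := exists_averaging_projection X hXY.1 ρ
  let π : RoeRepresentation X :=
    { H := UniformSpace.Completion f.PreGNS
      hom := f.gns }
  let Ω : π.H := ((f.toPreGNS 1 : f.PreGNS) : UniformSpace.Completion f.PreGNS)
  have hΩ : ∀ T, inner ℂ Ω (π.hom T Ω) = f.toLin T := f.gns_inner
  have hre : ∀ (T : AlgebraicRoe X) (B : ℝ),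
      (∀ᶠ n in (U : Filter ℕ), (kernelMean Y t T n).re ≤ B) → (f.toLin T).re ≤ B :=
    fun T B h => le_of_tendsto ((Complex.continuous_re.tendsto _).comp (hf T)) h
  have hone : f.toLin 1 = 1 := by
    refine tendsto_nhds_unique (hf 1) ?_
    simp only [show kernelMean Y t (1 : AlgebraicRoe X) = fun _ => 1 from
      funext fun n => kernelMean_one hXY.1 n]
    exact tendsto_const_nhds
  have hnorm : ‖Ω‖ = 1 := by
    have h1 := norm_sq_eq_re_inner_star_mul π.hom 1 Ω
    rw [hΩ, star_one, one_mul, hone, map_one, one_apply_eq_self] at h1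
    have h2 : ‖Ω‖ ^ 2 = 1 := by simpa using h1
    exact (pow_eq_one_iff_of_nonneg (norm_nonneg Ω) two_ne_zero).1 h2
  have hlap : (f.toLin (roeLaplacian X)).re ≤ γ / 16 := by
    refine hre _ _ (Eventually.of_forall fun n => ?_)
    refine (kernelMean_roeLaplacian_re_le hd ht0 ht1.le (fun n x y hxy => ?_) n).trans ht
    have := (hL n x y).2
    rwa [SimpleGraph.dist_eq_one_iff_adj.2 hxy, mul_one] at this
  have hAω : (f.toLin A).re ≤ 1 / 16 := by
    refine hre _ _ ?_
    filter_upwards [hcard.eventually_ge_atTop (ρ + 1)] with n hn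
    refine (kernelMean_re_le_of_spread ht0 ht1.le (δ := 1 / ((ρ : ℝ) + 1)) (by positivity) (hN n)
      (haA n) (ha0 n) (fun x => ?_) (fun x y => haρ n x y hn)).trans ?_
    · have := hA1 n x
      simp only [haA, ← Complex.ofReal_sum] at this
      exact_mod_cast this
    · have h1 : (N : ℝ) * (1 / ((ρ : ℝ) + 1)) ≤ 1 / 32 := by
        rw [mul_one_div, div_le_iff₀ (by positivity)]
        linarith
      linarith
  have hsa : IsSelfAdjoint (π.hom (roeLaplacian X)) := by
    rw [isSelfAdjoint_iff, ← map_star, star_roeLaplacian]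
  obtain ⟨w, hw, hwΩ⟩ := exists_kernel_approximation _ hsa hγ
    ((spectrum_representation_subset X π _).trans hspec) Ω
  rw [hΩ] at hwΩ
  have hdist : ‖Ω - w‖ ≤ 1 / 4 := by
    have h1 : ‖Ω - w‖ ^ 2 ≤ (1 / 4) ^ 2 := by
      have h2 : γ * ‖Ω - w‖ ^ 2 ≤ γ * (1 / 16) := by linarith
      have h3 := le_of_mul_le_mul_left h2 hγ
      linarith
    exact (abs_le_of_sq_le_sq' h1 (by norm_num)).2
  have hAΩ : ‖π.hom A Ω‖ ≤ 1 / 4 := by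
    have h1 := norm_sq_eq_re_inner_star_mul π.hom A Ω
    rw [hΩ, hAstar, hAA] at h1
    have h2 : ‖π.hom A Ω‖ ^ 2 ≤ (1 / 4) ^ 2 := by linarith
    exact (abs_le_of_sq_le_sq' h2 (by norm_num)).2
  have hAw : π.hom A w = w := map_eq_self_of_map_roeLaplacian π.hom hw A hA1
  have h1 : ‖w‖ ≤ 1 / 2 := by
    -- Both terms have norm at most `1/4`, so `1 = ‖Ω‖ ≤ 1/4 + 1/2`.
    have h2 : w = π.hom A Ω - π.hom A (Ω - w) := by rw [map_sub, hAw]; abel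
    rw [h2]
    have h3 := norm_apply_le_of_projection π.hom hAstar hAA (Ω - w)
    have h4 := norm_sub_le (π.hom A Ω) (π.hom A (Ω - w))
    linarith
  have h2 : ‖Ω‖ ≤ ‖Ω - w‖ + ‖w‖ := by
    have := norm_add_le (Ω - w) w
    rwa [sub_add_cancel] at this
  linarith

/-- Geometric property (T) forces a positive proportion of edges with short detours. -/
theorem GeometricPropertyT.exists_detourEdges (hT : GeometricPropertyT X)
    {Y : ∀ n, SimpleGraph (V n)} (hXY : SameCoarseStructure X Y) :
    ∃ (k : ℕ) (ε : ℝ), 0 < ε ∧ ∀ᶠ n in atTop,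
      ε * (Fintype.card (V n) : ℝ) ≤ (((Y n).detourEdges k).ncard : ℝ) := by
  obtain ⟨hconn, hcard, hdeg, γ, hγ, hspec⟩ := hT
  by_contra! hcon
  -- Diagonal choice: detour length `j` and density `1/(j+1)` at once. Detour edges increase with
  -- the permitted length, so one subsequence serves every `k`.
  have hfreq : ∀ j : ℕ, ∃ n, j ≤ n ∧
      (((Y n).detourEdges j).ncard : ℝ) < 1 / ((j : ℝ) + 1) * (Fintype.card (V n) : ℝ) := by
    intro j
    have h := hcon j (1 / ((j : ℝ) + 1)) (by positivity)
    obtain ⟨n, hn, hlt⟩ := (Filter.frequently_atTop.1 h) j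
    exact ⟨n, hn, hlt⟩
  choose m hm hlt using hfreq
  have hm' : Tendsto m atTop atTop := tendsto_atTop_mono hm tendsto_id
  let U : Ultrafilter ℕ := (Ultrafilter.of atTop).map m
  have hUle : ((U : Filter ℕ)) ≤ map m atTop := Filter.map_mono (Ultrafilter.of_le _)
  refine not_tendsto_detourEdges_of_spectral_gap hXY hγ hspec U
    (hcard.mono_left (hUle.trans hm')) fun k => ?_
  refine Tendsto.mono_left ?_ hUle
  rw [tendsto_map'_iff]
  refine squeeze_zero' (Eventually.of_forall fun j => div_nonneg (Nat.cast_nonneg _)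
    (Nat.cast_nonneg _)) ?_
    tendsto_one_div_add_atTop_nhds_zero_nat
  filter_upwards [eventually_ge_atTop k] with j hj
  have hpos : 0 < (Fintype.card (V (m j)) : ℝ) := by
    have := (hconn (m j)).nonempty
    exact_mod_cast Fintype.card_pos
  rw [Function.comp_apply, div_le_iff₀ hpos]
  refine le_trans ?_ (hlt j).le
  have : ((Y (m j)).detourEdges k).ncard ≤ ((Y (m j)).detourEdges j).ncard := by
    refine Set.ncard_le_ncard ?_ (Set.toFinite _)
    rintro e ⟨he, x, y, p, h1, h2, h3⟩
    exact ⟨he, x, y, p, h1, h2, h3.trans hj⟩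
  exact_mod_cast this

end Main

theorem mainTheorem4 {V : ℕ → Type u} [∀ n, Fintype (V n)] [∀ n, DecidableEq (V n)]
    (X : ∀ n, SimpleGraph (V n)) (hconn : ∀ n, (X n).Connected) :
    (∀ d : ℕ, DegreeAtMost X d → ∀ (R : ℕ) (ε : ℝ), 0 < R → 0 < ε →
      (∀ n, ε * (Fintype.card (V n) : ℝ) ≤
        (Module.finrank ℝ (shortCycleSpace (X n) R) : ℝ)) →
      combinatorialCost X ≤ liminfEdgeDensity X - ε / (d : ℝ) ^ (R - 1)) ∧
    (GeometricPropertyT X →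
      ¬ ∃ Y : ∀ n, SimpleGraph (V n),
        SameCoarseStructure X Y ∧ liminfEdgeDensity Y = combinatorialCost X) := by
  refine ⟨fun d hd R ε _ hε hZ => combinatorialCost_le_of_shortCycleSpace hconn hd hε hZ, ?_⟩
  rintro hT ⟨Y, hXY, hY⟩
  obtain ⟨k, ε, hε, hF⟩ := hT.exists_detourEdges hXY
  have hdeg : UniformlyBoundedDegree X := hT.2.2.choose
  obtain ⟨d, hd⟩ := hXY.exists_degree_bound
  -- Raising the bound by one makes the denominator positive; for `d = 0` and `k > 0` the quotient
  -- would be 0 by convention and the drop not strict.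
  have hd' : DegreeAtMost Y (d + 1) := fun n x => (hd n x).trans (Nat.le_succ d)
  have h1 := combinatorialCost_le_sub hXY hd' hε hF
  have h2 : 0 < ε / ((d + 1 : ℕ) : ℝ) ^ k := by positivity
  linarith
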